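/- **Conventions.** A geodesic metric space $X$ is *1-hyperbolic* if every side of every geodesic triangle lies in the $1$-neighborhood of the union of the other two sides. An arc-length parametrized path $\alpha:I\to X$ is a *$(\lambda,\epsilon)$-quasigeodesic* if $b-a\le\lambda\,d(\alpha(a),\alpha(b))+\epsilon$ for all $[a,b]\subseteq I$, and an *$N$-local* $(\lambda,\epsilon)$-quasigeodesic if its restriction to every $[a,b]\subseteq I$ with $b-a\le N$ is a $(\lambda,\epsilon)$-quasigeodesic. Fix positive integers $K,L,N_0$ such that in every 1-hyperbolic space each $N_0$-local $(1,100)$-quasigeodesic is a $(K,K)$-quasigeodesic, and any two $(K,K)$-quasigeodesics with the same endpoints are $L$-Hausdorff close. Put $N_1:=1000LK^2N_0$. Neighborhoods are closed: the $r$-neighborhood of $A$ is the set of points at distance at most $r$ from some point of $A$. Let a group $G$ act by isometries on a 1-hyperbolic geodesic metric space $X$ with base-point $x$. Write $|g|_x=d(x,gx)$, $\|g\|=\inf_{y\in X}d(y,gy)$, and $|M|_x=\sum_i|g_i|_x$ for $M=(g_1,\dots,g_n)\in G^n$. Two $n$-tuples are *Nielsen-equivalent* if a finite chain of moves $g_i\mapsto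 g_i^{-1}$, $g_i\mapsto g_ig_j$ $(i\ne j)$, $g_i\leftrightarrow g_j$ transforms one into the other. The tuple $M$ is *minimal* if $|M|_x\le|M'|_x+1$ for every $M'$ Nielsen-equivalent to $M$. By $[p,q]$ we denote any geodesic segment from $p$ to $q$; the statements below hold for all choices of these segments. For $M=(g_1,\dots,g_n)$, $U=\langle M\rangle$ and a number $d$ consider the conditions: 1. The map $U\to X$, $u\mapsto ux$, is a quasi-isometric embedding, where $U$ (free on $M$) carries the free group word metric. 2. (with constant $d$) For every $u=g_{i_1}^{\epsilon_1}\cdots g_{i_k}^{\epsilon_k}$, $k\ge1$, $\epsilon_j=\pm1$, the segment $[x,ux]$ lies in the $d$-neighborhood of $\bigcup_{j=1}^k g_{i_1}^{\epsilon_1}\cdots g_{i_{j-1}}^{\epsilon_{j-1}}[x,g_{i_j}^{\epsilon_j}x]$. 3. (with constant $d$) For every freely reduced $u=g_{i_1}^{\epsilon_1}\cdots g_{i_k}^{\epsilon_k}$ and every $1\le j\le k$, $|u|_x\ge|g_{i_j}|_x-d$. For $m\ge1$ let $\mathcal T(m)$ be the assertion: there are positive numbers $d_2(m),d_3(m)$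 and, for every $c>0$, positive numbers $d_1(m,c),d_4(m,c)$ such that for all $G$, $X$, $x$ as above every minimal $m$-tuple $M=(g_1,\dots,g_m)\in G^m$ is either Nielsen-equivalent to a tuple $(g_1',\dots,g_m')$ with $\|g_1'\|\le d_1(m,c)$, or $U=\langle M\rangle$ is freely generated by $M$, conditions 1, 2 (with constant $d_2(m)$) and 3 (with constant $d_3(m)$) hold, and every subsegment of length greater than $d_4(m,c)$ of a geodesic segment $[x,ux]$, $u\in U$, meets the $b$-neighborhood of $Ux$, where $b=\max_i(|g_i|_x/2-c)$. **Proposition.** Let $n\ge2$ and suppose that $\mathcal T(n-1)$ holds. Then there exist positive numbers $c_2=c_2(n)$, $c_3=c_3(n)$ and, for every real $T\ge N_1$, a positive number $c_1=c_1(n,T)$ (none depending on $G$, $X$, $x$ or $M$) such that for all $G$, $X$, $x$ as above, every minimal $n$-tuple $M=(g_1,\dots,g_n)\in G^n$ with $|g_i|_x\le|g_n|_x$ for $1\le i\le n-1$ is either Nielsen-equivalent to a tuple $M'=(g_1',\dots,g_n')$ with $\|g_1'\|\le c_1$, or $U=\langle M\rangle$ is freely generated by $M$, conditions 1, 2 (with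 constant $c_2$) and 3 (with constant $c_3$) hold, and moreover: 4. For every product $w=h_1g_n^{\epsilon_1}h_2g_n^{\epsilon_2}\cdots h_lg_n^{\epsilon_l}h_{l+1}$ with $l\ge0$, $\epsilon_i\in\{-1,1\}$, $h_i\in H=\langle g_1,\dots,g_{n-1}\rangle$, and $h_i\ne1$ whenever $2\le i\le l$ and $\epsilon_{i-1}=-\epsilon_i$, the $(2L+100)$-neighborhood of every subsegment of $[x,wx]$ of length at least $10T$ contains a subsegment of length at least $T$ of one of the segments $h_1g_n^{\epsilon_1}\cdots g_n^{\epsilon_{i-1}}h_i[x,g_n^{\epsilon_i}x]$ $(1\le i\le l)$ or $h_1g_n^{\epsilon_1}\cdots g_n^{\epsilon_{i-1}}[x,h_ix]$ $(1\le i\le l+1)$. -/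

import Mathlib

open Set

universe u v

namespace NielsenHyp

/-! ### Nielsen equivalence -/

/-- One elementary Nielsen move on an `n`-tuple of elements of a group. -/
inductive NielsenMove {G : Type u} [Group G] {n : ℕ} : (Fin n → G) → (Fin n → G) → Prop
  | inv (M : Fin n → G) (i : Fin n) :
      NielsenMove M (Function.update M i (M i)⁻¹)
  | mul (M : Fin n → G) (i j : Fin n) (hij : i ≠ j) :
      NielsenMove M (Function.update M i (M i * M j))
  | swap (M : Fin n → G) (i j : Fin n) (hij : i ≠ j) :
      NielsenMove M (M ∘ Equiv.swap i j)

/-- Two tuples are Nielsen-equivalent if a finite chain of elementary Nielsen moves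
transforms the first into the second. -/
def NielsenEquiv {G : Type u} [Group G] {n : ℕ} (M M' : Fin n → G) : Prop :=
  Relation.ReflTransGen NielsenMove M M'

/-! ### Geodesics, hyperbolicity, quasigeodesics -/

/-- `γ`, restricted to `[0, dist p q]`, is a geodesic path from `p` to `q` parametrized by
arc length; its image is a geodesic segment `[p, q]`. -/
def IsGeodesicFromTo {X : Type v} [MetricSpace X] (γ : ℝ → X) (p q : X) : Prop :=
  γ 0 = p ∧ γ (dist p q) = q ∧
    ∀ s ∈ Icc (0 : ℝ) (dist p q), ∀ t ∈ Icc (0 : ℝ) (dist p q), dist (γ s) (γ t) = |s - t|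

/-- A geodesic metric space all of whose geodesic triangles are `δ`-thin: every side lies in the
`δ`-neighborhood of the union of the other two. -/
def IsHyperbolicSpace (δ : ℝ) (X : Type v) [MetricSpace X] : Prop :=
  (∀ p q : X, ∃ γ : ℝ → X, IsGeodesicFromTo γ p q) ∧
  ∀ (p q r : X) (α β γ : ℝ → X),
    IsGeodesicFromTo α p q → IsGeodesicFromTo β p r → IsGeodesicFromTo γ q r →
    ∀ t ∈ Icc (0 : ℝ) (dist p q),
      (∃ s ∈ Icc (0 : ℝ) (dist p r), dist (α t) (β s) ≤ δ) ∨
      (∃ s ∈ Icc (0 : ℝ) (dist q r), dist (α t) (γ s) ≤ δ)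

/-- A naturally (arc length) parametrized path on the interval `I` is a
`(lam, ε)`-quasigeodesic. -/
def IsQuasigeodesicOn {X : Type v} [MetricSpace X] (α : ℝ → X) (I : Set ℝ) (lam ε : ℝ) : Prop :=
  I.OrdConnected ∧ HasUnitSpeedOn α I ∧
    ∀ a b : ℝ, a ≤ b → Icc a b ⊆ I → b - a ≤ lam * dist (α a) (α b) + ε

/-- `T`-local `(lam, ε)`-quasigeodesics. -/
def IsLocalQuasigeodesicOn {X : Type v} [MetricSpace X] (T : ℝ) (α : ℝ → X) (I : Set ℝ)
    (lam ε : ℝ) : Prop :=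
  I.OrdConnected ∧ HasUnitSpeedOn α I ∧
    ∀ a b : ℝ, a ≤ b → Icc a b ⊆ I → b - a ≤ T → IsQuasigeodesicOn α (Icc a b) lam ε

/-- The defining property of the constants `K`, `L`, `N₀`: they are positive integers such that
in every 1-hyperbolic space each `N₀`-local `(1, 100)`-quasigeodesic is a
`(K, K)`-quasigeodesic, and any two `(K, K)`-quasigeodesics with the same endpoints are
`L`-Hausdorff close. -/
def AdmissibleConstants (K L N₀ : ℕ) : Prop :=
  0 < K ∧ 0 < L ∧ 0 < N₀ ∧
  (∀ (X : Type v) [MetricSpace X], IsHyperbolicSpace 1 X →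
    ∀ (α : ℝ → X) (I : Set ℝ),
      IsLocalQuasigeodesicOn (N₀ : ℝ) α I 1 100 → IsQuasigeodesicOn α I K K) ∧
  (∀ (X : Type v) [MetricSpace X], IsHyperbolicSpace 1 X →
    ∀ (α β : ℝ → X) (a b : ℝ), 0 ≤ a → 0 ≤ b →
      IsQuasigeodesicOn α (Icc 0 a) K K → IsQuasigeodesicOn β (Icc 0 b) K K →
      α 0 = β 0 → α a = β b →
      (∀ s ∈ Icc (0 : ℝ) a, ∃ t ∈ Icc (0 : ℝ) b, dist (α s) (β t) ≤ L) ∧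
      (∀ t ∈ Icc (0 : ℝ) b, ∃ s ∈ Icc (0 : ℝ) a, dist (α s) (β t) ≤ L))

/-- `N₁ = 1000 L K² N₀`. -/
def N1 (K L N₀ : ℕ) : ℕ := 1000 * L * K ^ 2 * N₀

/-! ### Displacement, translation length, minimal tuples -/

/-- `|g|_x = d(x, g x)`. -/
def disp {G : Type u} {X : Type v} [Group G] [MetricSpace X] [MulAction G X] (x : X) (g : G) : ℝ :=
  dist x (g • x)

/-- The translation length `‖g‖ = inf_y d(y, g y)`. -/
noncomputable def translationLength {G : Type u} (X : Type v) [Group G] [MetricSpace X]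
    [MulAction G X] (g : G) : ℝ :=
  ⨅ y : X, dist y (g • y)

/-- `|M|_x`, the sum of the displacements of the entries. -/
def tupleDisp {G : Type u} {X : Type v} [Group G] [MetricSpace X] [MulAction G X] {n : ℕ}
    (x : X) (M : Fin n → G) : ℝ :=
  ∑ i, disp x (M i)

/-- Minimal tuples: `|M| ≤ |M'| + 1` for every `M'` Nielsen-equivalent to `M`. -/
def IsMinimalTuple {G : Type u} {X : Type v} [Group G] [MetricSpace X] [MulAction G X] {n : ℕ}
    (x : X) (M : Fin n → G) : Prop :=
  ∀ M' : Fin n → G, NielsenEquiv M M' → tupleDisp x M ≤ tupleDisp x M' + 1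

/-- `M` is Nielsen-equivalent to a tuple whose first entry has translation length at most `c`. -/
def HasShortFirst {G : Type u} (X : Type v) [Group G] [MetricSpace X] [MulAction G X] {n : ℕ}
    (M : Fin n → G) (c : ℝ) : Prop :=
  ∃ M' : Fin n → G, NielsenEquiv M M' ∧
    ∃ i : Fin n, (i : ℕ) = 0 ∧ translationLength X (M' i) ≤ c

/-! ### Words and the conclusions about the subgroup generated by a tuple -/

/-- The letter `(i, true)` stands for `g_i`, the letter `(i, false)` for `g_i⁻¹`. -/
def letter {G : Type u} [Group G] {n : ℕ} (M : Fin n → G) (a : Fin n × Bool) : G :=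
  if a.2 then M a.1 else (M a.1)⁻¹

/-- The product in `G` of the letters of a word. -/
def wordProd {G : Type u} [Group G] {n : ℕ} (M : Fin n → G) (w : List (Fin n × Bool)) : G :=
  (w.map (letter M)).prod

/-- The subgroup generated by the tuple `M` is free with free basis `M`. -/
def IsFreelyGenerating {G : Type u} [Group G] {n : ℕ} (M : Fin n → G) : Prop :=
  Function.Injective (FreeGroup.lift M : FreeGroup (Fin n) →* G)

/-- The orbit map `u ↦ u x` on the group freely generated by `M`, with the word metric
`(a, b) ↦ |a⁻¹ b|` of the free group, is a quasi-isometric embedding. -/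
def OrbitMapIsQIEmbedding {G : Type u} {X : Type v} [Group G] [MetricSpace X] [MulAction G X]
    {n : ℕ} (x : X) (M : Fin n → G) : Prop :=
  ∃ lam ε : ℝ, 1 ≤ lam ∧ 0 ≤ ε ∧ ∀ a b : FreeGroup (Fin n),
    (FreeGroup.norm (a⁻¹ * b) : ℝ) / lam - ε
        ≤ dist (FreeGroup.lift M a • x) (FreeGroup.lift M b • x) ∧
    dist (FreeGroup.lift M a • x) (FreeGroup.lift M b • x)
        ≤ lam * (FreeGroup.norm (a⁻¹ * b) : ℝ) + ε

/-- For every nonempty word `u = a_1 ⋯ a_k` in the letters `g_i^{±1}`, every geodesic segment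
`[x, u x]` lies in the `d`-neighborhood of the union of the segments
`a_1 ⋯ a_{j-1} [x, a_j x]`, whatever geodesic segments are chosen. -/
def FellowTravels {G : Type u} {X : Type v} [Group G] [MetricSpace X] [MulAction G X]
    {n : ℕ} (x : X) (M : Fin n → G) (d : ℝ) : Prop :=
  ∀ w : List (Fin n × Bool), w ≠ [] →
    ∀ γ : ℝ → X, IsGeodesicFromTo γ x (wordProd M w • x) →
    ∀ t ∈ Icc (0 : ℝ) (dist x (wordProd M w • x)),
      ∃ j : Fin w.length,
        ∀ β : ℝ → X, IsGeodesicFromTo β x (letter M (w.get j) • x) →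
          ∃ s ∈ Icc (0 : ℝ) (dist x (letter M (w.get j) • x)),
            dist (γ t) (wordProd M (w.take j) • β s) ≤ d

/-- For every freely reduced word `u` and every letter `g_i^{±1}` occurring in it,
`|u|_x ≥ |g_i|_x - d`. -/
def LengthBound {G : Type u} {X : Type v} [Group G] [MetricSpace X] [MulAction G X]
    {n : ℕ} (x : X) (M : Fin n → G) (d : ℝ) : Prop :=
  ∀ w : List (Fin n × Bool), FreeGroup.IsReduced w →
    ∀ a ∈ w, disp x (M a.1) - d ≤ disp x (wordProd M w)

/-- Every subsegment of length greater than `d` of a geodesic segment `[x, u x]`, with `u` in the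
subgroup `U` generated by `M`, meets the `b`-neighborhood of the orbit `U x`, where `b` is the
maximum over `i` of `|g_i|_x / 2 - c`. -/
def MeetsOrbitNeighborhood {G : Type u} {X : Type v} [Group G] [MetricSpace X] [MulAction G X]
    {n : ℕ} (x : X) (M : Fin n → G) (c d : ℝ) : Prop :=
  ∀ u ∈ Subgroup.closure (range M),
    ∀ γ : ℝ → X, IsGeodesicFromTo γ x (u • x) →
    ∀ a b : ℝ, 0 ≤ a → b ≤ dist x (u • x) → d < b - a →
      ∃ t ∈ Icc a b, ∃ v ∈ Subgroup.closure (range M), ∃ i : Fin n,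
        dist (γ t) (v • x) ≤ disp x (M i) / 2 - c

/-- The main technical theorem for `n`-tuples: for every `c > 0`, every minimal `n`-tuple in a
group acting by isometries on a pointed 1-hyperbolic space either is Nielsen-equivalent to a tuple
with a first entry of translation length at most `d₁(n, c)`, or freely generates a subgroup with
the four listed geometric properties, where `d₂`, `d₃` depend only on `n` and `d₄` on `n`, `c`. -/
def TechnicalTheorem (n : ℕ) : Prop :=
  ∃ d₂ d₃ : ℝ, 0 < d₂ ∧ 0 < d₃ ∧ ∀ c : ℝ, 0 < c → ∃ d₁ d₄ : ℝ, 0 < d₁ ∧ 0 < d₄ ∧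
    ∀ (G : Type u) (X : Type v) [Group G] [MetricSpace X] [MulAction G X] [IsIsometricSMul G X],
      IsHyperbolicSpace 1 X →
      ∀ (x : X) (M : Fin n → G), IsMinimalTuple x M →
        HasShortFirst X M d₁ ∨
        (IsFreelyGenerating M ∧ OrbitMapIsQIEmbedding x M ∧ FellowTravels x M d₂ ∧
          LengthBound x M d₃ ∧ MeetsOrbitNeighborhood x M c d₄)

/-! ### Alternating products -/

/-- With `g = g_n`, the prefix `h_1 g^{ε_1} ⋯ h_i g^{ε_i}`; the syllables are numbered from
zero, so `h 0, ε 0, h 1, ε 1, …` are `h_1, ε_1, h_2, ε_2, …`. -/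
def altPrefix {G : Type u} [Group G] (g : G) (h : ℕ → G) (ε : ℕ → ℤˣ) : ℕ → G
  | 0 => 1
  | i + 1 => altPrefix g h ε i * h i * g ^ ((ε i : ℤˣ) : ℤ)

/-- The `r`-neighborhood of the part of the path `γ` over `[a, b]` contains, for every choice of
the geodesic segment `[x, k x]`, a subsegment of `p [x, k x]` of length at least `T`. -/
def NearPieceOf {G : Type u} {X : Type v} [Group G] [MetricSpace X] [MulAction G X]
    (x : X) (γ : ℝ → X) (a b r T : ℝ) (p k : G) : Prop :=
  ∀ β : ℝ → X, IsGeodesicFromTo β x (k • x) →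
    ∃ s t : ℝ, 0 ≤ s ∧ t ≤ dist x (k • x) ∧ T ≤ t - s ∧
      ∀ q ∈ Icc s t, ∃ y ∈ Icc a b, dist (p • β q) (γ y) ≤ r

/-- For every alternating product `w = h_1 g^{ε_1} h_2 ⋯ h_l g^{ε_l} h_{l+1}` with `h_i ∈ H`,
`ε_i = ±1`, and `h_i ≠ 1` whenever it stands between opposite powers of `g`: the
`r`-neighborhood of each subsegment of length at least `10 T` of a geodesic `[x, w x]` contains a
subsegment of length at least `T` of a segment `h_1 g^{ε_1} ⋯ h_i [x, g^{ε_i} x]` or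
`h_1 g^{ε_1} ⋯ g^{ε_{i-1}} [x, h_i x]`. -/
def AlternatingProductsTrack {G : Type u} {X : Type v} [Group G] [MetricSpace X] [MulAction G X]
    (x : X) (H : Subgroup G) (g : G) (r T : ℝ) : Prop :=
  ∀ (l : ℕ) (h : ℕ → G) (ε : ℕ → ℤˣ),
    (∀ i ≤ l, h i ∈ H) →
    (∀ i, i + 1 < l → ε i = -ε (i + 1) → h (i + 1) ≠ 1) →
    ∀ γ : ℝ → X, IsGeodesicFromTo γ x ((altPrefix g h ε l * h l) • x) →
    ∀ a b : ℝ, 0 ≤ a → b ≤ dist x ((altPrefix g h ε l * h l) • x) → 10 * T ≤ b - a →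
      (∃ i < l, NearPieceOf x γ a b r T (altPrefix g h ε i * h i) (g ^ ((ε i : ℤˣ) : ℤ))) ∨
      (∃ i ≤ l, NearPieceOf x γ a b r T (altPrefix g h ε i) (h i))

end NielsenHyp

open NielsenHyp

namespace NielsenHyp

/-! ### Four-point hyperbolicity -/

section Geometry

variable {X : Type v} [MetricSpace X]

/-! Let `k` be the index of a longest entry among those with index in a subset `S`, put g = `M k`,
and let H be the subgroup generated by the other entries of `S`. The proof establishes, by induction
on the size of `S`, that words in the entries of `S` behave like words in a free group acting on a
tree, with errors independent of the action.

Nielsen moves replace g by any element of HgH and leave the other entries alone. Hence minimality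
makes g almost shortest in HgH, and if no short first entry can be produced, every element of gH
moves every point far. Nontrivial elements of H also move every point far (`lt_dist_of_mem_spanOf`):
a middle point of [x, h^m x] comes near the orbit, so a conjugate of a slow h has displacement much
smaller than some |g_i|. Its reduced word then avoids g_i, and the set of entries shrinks.

Let m be the midpoint of [x, gx]. If the Gromov product at m of a point near Hx and a point near gHx
were large, two geodesics from m would run together while both approach their orbits to within less
than |g|/2, giving an element of HgH shorter than g by more than 1 (`OrbitDense.gromov_bounded`). So
for an alternating product w, the path through x, the midpoints of the g-edges and wx has long sides
and bounded Gromov products at its corners (`IsEdge.isBrokenPath`). The four-point inequality passes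
from these local conditions to global control: freeness, the quasi-isometric embedding and the
length bound follow.

A stretch of [x, wx] of length 10T, shorter than every side, lies near two consecutive sides, hence
near five factor segments. Seven points spaced by 3T/2 put two on the same segment, which is the
tracking property. Tracking at a large scale in turn shows that geodesics come close to the orbit of
the enlarged subgroup, which closes the induction.

The order of quantifiers in `SubtupleTheorem` is essential: `d₂` and `d₃` precede `c`, so `c` may be
chosen large against `d₃` and against constants found with smaller `c`. -/

/-- The four-point inequality with additive constant `4`. -/
def FourPoint (X : Type v) [MetricSpace X] : Prop :=
  ∀ a b c o : X, dist a c + dist b o ≤ dist a b + dist c o + 4 ∨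
    dist a c + dist b o ≤ dist b c + dist a o + 4

namespace IsGeodesicFromTo

variable {γ : ℝ → X} {p q : X}

lemma dist_left (h : IsGeodesicFromTo γ p q) {t : ℝ} (ht : t ∈ Icc (0 : ℝ) (dist p q)) :
    dist p (γ t) = t := by
  have := h.2.2 0 ⟨le_rfl, dist_nonneg⟩ t ht
  rw [h.1] at this
  rw [this, zero_sub, abs_neg, abs_of_nonneg ht.1]

lemma dist_right (h : IsGeodesicFromTo γ p q) {t : ℝ} (ht : t ∈ Icc (0 : ℝ) (dist p q)) :
    dist (γ t) q = dist p q - t := by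
  have := h.2.2 t ht (dist p q) ⟨dist_nonneg, le_rfl⟩
  rw [h.2.1] at this
  rw [this, abs_sub_comm, abs_of_nonneg (by linarith [ht.2])]

lemma dist_param (h : IsGeodesicFromTo γ p q) {s t : ℝ} (hs : s ∈ Icc (0 : ℝ) (dist p q))
    (ht : t ∈ Icc (0 : ℝ) (dist p q)) (hst : s ≤ t) : dist (γ s) (γ t) = t - s := by
  rw [h.2.2 s hs t ht, abs_sub_comm, abs_of_nonneg (by linarith)]

lemma sub (h : IsGeodesicFromTo γ p q) {a b : ℝ} (ha : 0 ≤ a) (hab : a ≤ b)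
    (hb : b ≤ dist p q) : IsGeodesicFromTo (fun t => γ (a + t)) (γ a) (γ b) := by
  have hd : dist (γ a) (γ b) = b - a :=
    h.dist_param ⟨ha, hab.trans hb⟩ ⟨ha.trans hab, hb⟩ hab
  refine ⟨by simp, by simp [hd], fun s hs t ht => ?_⟩
  rw [hd] at hs ht
  rw [h.2.2 _ ⟨by linarith [hs.1], by linarith [hs.2]⟩ _ ⟨by linarith [ht.1], by linarith [ht.2]⟩]
  congr 1; ring

lemma smul {G : Type u} [Group G] [MulAction G X] [IsIsometricSMul G X]
    (h : IsGeodesicFromTo γ p q) (g : G) :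
    IsGeodesicFromTo (fun t => g • γ t) (g • p) (g • q) := by
  refine ⟨by simp [h.1], by simp [h.2.1], fun s hs t ht => ?_⟩
  rw [dist_smul] at hs ht
  simpa using h.2.2 s hs t ht

end IsGeodesicFromTo

/-- Along a side of a thin triangle the distance to the opposite vertex behaves as in a tripod: a
point is near one of the other sides, and that side leads to `r` without detour. -/
lemma IsHyperbolicSpace.dist_le (hX : IsHyperbolicSpace 1 X) {γ : ℝ → X} {p q : X}
    (hγ : IsGeodesicFromTo γ p q) {t : ℝ} (ht : t ∈ Icc (0 : ℝ) (dist p q)) (r : X) :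
    dist (γ t) r ≤ dist p r - t + 2 ∨ dist (γ t) r ≤ dist q r - (dist p q - t) + 2 := by
  obtain ⟨β, hβ⟩ := hX.1 p r
  obtain ⟨σ, hσ⟩ := hX.1 q r
  have h1 := hγ.dist_left ht
  have h2 := hγ.dist_right ht
  rcases hX.2 p q r γ β σ hγ hβ hσ t ht with ⟨s, hs, h⟩ | ⟨s, hs, h⟩
  · left
    have h3 := hβ.dist_left hs
    have h4 := hβ.dist_right hs
    have h5 := dist_triangle (γ t) (β s) r
    have h6 := dist_triangle p (β s) (γ t)
    rw [dist_comm (β s) (γ t)] at h6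
    linarith
  · right
    have h3 := hσ.dist_left hs
    have h4 := hσ.dist_right hs
    have h5 := dist_triangle (γ t) (σ s) r
    have h6 := dist_triangle q (σ s) (γ t)
    rw [dist_comm (σ s) (γ t), dist_comm q (γ t)] at h6
    linarith

lemma IsHyperbolicSpace.fourPoint (hX : IsHyperbolicSpace 1 X) : FourPoint X := by
  intro a b c o
  obtain ⟨γ, hγ⟩ := hX.1 a c
  have t1 := dist_triangle a c o
  have t2 := dist_triangle c a o
  have t3 := dist_triangle a o c
  rw [dist_comm c a] at t2
  rw [dist_comm o c] at t3
  -- The parameter of the inner point of the triangle `a`, `c`, `o`, where both upper bounds for the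
  -- distance to `o` agree. The path from `b` to `o` through this point proves the inequality.
  have ht : (dist a c + dist a o - dist c o) / 2 ∈ Icc (0 : ℝ) (dist a c) :=
    ⟨by linarith, by linarith⟩
  have h1 := hX.dist_le hγ ht o
  have h2 := hX.dist_le hγ ht b
  have h3 := dist_triangle b (γ ((dist a c + dist a o - dist c o) / 2)) o
  rw [dist_comm b (γ _)] at h3
  rw [dist_comm b c]
  rcases h1 with h1 | h1 <;> rcases h2 with h2 | h2
  · left; linarith
  · right; linarith
  · left; linarith
  · right; linarith

/-- The tripod estimate for points that lie on `[p, q]` only up to `ε`. No geodesic is mentioned, so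
it applies to arbitrary almost-intermediate points. -/
lemma FourPoint.dist_le (hX : FourPoint X) {p q z : X} {ε : ℝ}
    (hz : dist p z + dist z q ≤ dist p q + ε) (r : X) :
    dist z r ≤ dist p r - dist p z + ε + 4 ∨ dist z r ≤ dist q r - dist z q + ε + 4 := by
  have := hX p z q r
  rcases this with h | h
  · right; linarith
  · left; linarith

lemma FourPoint.split (hX : FourPoint X) {p q z : X} {ε : ℝ}
    (hz : dist p z + dist z q ≤ dist p q + ε) (r : X) :
    dist p z + dist z r ≤ dist p r + (ε + 4) ∨ dist r z + dist z q ≤ dist r q + (ε + 4) := by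
  rcases hX.dist_le hz r with h | h
  · left; linarith
  · right; rw [dist_comm r z, dist_comm r q]; linarith

/-- A point almost on `[p, q]` is close to any geodesic from `p` to `q`. -/
lemma FourPoint.exists_near (hX : FourPoint X) {γ : ℝ → X} {p q z : X} {ε : ℝ}
    (hγ : IsGeodesicFromTo γ p q) (hz : dist p z + dist z q ≤ dist p q + ε) :
    ∃ t ∈ Icc (0 : ℝ) (dist p q), dist z (γ t) ≤ ε + 4 := by
  have hε : 0 ≤ ε := by linarith [dist_triangle p z q]
  -- The minimum is needed because `dist p z` may exceed `dist p q` by up to `ε`.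
  have ht : min (dist p z) (dist p q) ∈ Icc (0 : ℝ) (dist p q) :=
    ⟨le_min dist_nonneg dist_nonneg, min_le_right _ _⟩
  refine ⟨_, ht, ?_⟩
  have h1 := hγ.dist_left ht
  have h2 := hγ.dist_right ht
  have h3 := hX.dist_le (p := p) (q := q) (z := γ (min (dist p z) (dist p q))) (ε := 0)
    (by linarith) z
  rw [h1, h2, dist_comm _ z, dist_comm q z] at h3
  have h4 := dist_nonneg (x := z) (y := q)
  rcases min_cases (dist p z) (dist p q) with ⟨h, h'⟩ | ⟨h, h'⟩ <;> rw [h] at h3 ⊢ <;>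
    rcases h3 with h3 | h3 <;> linarith

/-- Two points at bounded distance from a geodesic bound a subgeodesic; the points almost between
them are close to it. -/
lemma FourPoint.exists_near_sub (hX : FourPoint X) {γ : ℝ → X} {p q z : X} {ε : ℝ} {a b : ℝ}
    (hγ : IsGeodesicFromTo γ p q) (ha : 0 ≤ a) (hab : a ≤ b) (hb : b ≤ dist p q)
    (hz : dist (γ a) z + dist z (γ b) ≤ b - a + ε) :
    ∃ t ∈ Icc a b, dist z (γ t) ≤ ε + 4 := by
  have hd : dist (γ a) (γ b) = b - a :=
    hγ.dist_param ⟨ha, hab.trans hb⟩ ⟨ha.trans hab, hb⟩ hab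
  obtain ⟨t, ht, h⟩ := hX.exists_near (hγ.sub ha hab hb) (z := z) (ε := ε) (by rw [hd]; exact hz)
  rw [hd] at ht
  exact ⟨a + t, ⟨by linarith [ht.1], by linarith [ht.2]⟩, h⟩

/-- If `γ` and `β` come `28`-close at the parameters `t₁ < t₂` and `s₁, s₂`, then the part of
`β` between `s₁` and `s₂`, shortened by `33` at both ends, lies in the `16`-neighborhood of the
part of `γ` between `t₁` and `t₂`. -/
lemma FourPoint.fellow_travel (hX : FourPoint X) {γ β : ℝ → X} {p q p' q' : X}
    (hγ : IsGeodesicFromTo γ p q) (hβ : IsGeodesicFromTo β p' q') {t₁ t₂ s₁ s₂ s : ℝ}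
    (ht₁ : 0 ≤ t₁) (ht : t₁ ≤ t₂) (ht₂ : t₂ ≤ dist p q)
    (hs₁ : s₁ ∈ Icc (0 : ℝ) (dist p' q')) (hs₂ : s₂ ∈ Icc (0 : ℝ) (dist p' q'))
    (h₁ : dist (γ t₁) (β s₁) ≤ 28) (h₂ : dist (γ t₂) (β s₂) ≤ 28)
    (hs : min s₁ s₂ + 33 ≤ s) (hs' : s ≤ max s₁ s₂ - 33) :
    ∃ t ∈ Icc t₁ t₂, dist (β s) (γ t) ≤ 16 := by
  have hsm : s ∈ Icc (0 : ℝ) (dist p' q') :=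
    ⟨by linarith [le_min hs₁.1 hs₂.1], by linarith [max_le hs₁.2 hs₂.2]⟩
  have hd : dist (γ t₁) (γ t₂) = t₂ - t₁ := hγ.dist_param ⟨ht₁, ht.trans ht₂⟩ ⟨ht₁.trans ht, ht₂⟩ ht
  have key : dist (γ t₁) (β s) + dist (β s) (γ t₂) ≤ t₂ - t₁ + 12 := by
    have e1 := hβ.2.2 s₁ hs₁ s hsm
    have e2 := hβ.2.2 s hsm s₂ hs₂
    have e3 := hβ.2.2 s₁ hs₁ s₂ hs₂
    have hlt : |s₁ - s| + |s - s₂| = |s₁ - s₂| ∧ 33 ≤ |s₁ - s| ∧ 33 ≤ |s - s₂| := by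
      rcases le_total s₁ s₂ with h | h
      · rw [min_eq_left h] at hs
        rw [max_eq_right h] at hs'
        rw [abs_of_nonpos, abs_of_nonpos, abs_of_nonpos] <;> try linarith
        exact ⟨by ring, by linarith, by linarith⟩
      · rw [min_eq_right h] at hs
        rw [max_eq_left h] at hs'
        rw [abs_of_nonneg, abs_of_nonneg, abs_of_nonneg] <;> try linarith
        exact ⟨by ring, by linarith, by linarith⟩
    obtain ⟨l1, l2, l3⟩ := hlt
    rw [← e1, ← e2, ← e3] at l1
    rw [← e1] at l2
    rw [← e2] at l3
    have k1 := hX.dist_le (p := β s₁) (q := β s₂) (z := β s) (ε := 0) (by linarith) (γ t₁)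
    have k2 := hX.dist_le (p := β s₁) (q := β s₂) (z := β s) (ε := 0) (by linarith) (γ t₂)
    have k3 := hX (β s₂) (γ t₂) (γ t₁) (β s₁)
    have n1 := dist_nonneg (x := β s) (y := γ t₁)
    have n2 := dist_nonneg (x := β s) (y := γ t₂)
    have n3 := dist_nonneg (x := γ t₁) (y := γ t₂)
    rw [dist_comm (γ t₁) (β s)]
    rw [dist_comm (γ t₁) (β s₁)] at h₁ k3
    rw [dist_comm (γ t₂) (β s₂)] at h₂
    rw [dist_comm (γ t₂) (β s₁), dist_comm (γ t₂) (γ t₁), dist_comm (β s₂) (β s₁)] at k3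
    rcases k1 with k1 | k1 <;> rcases k2 with k2 | k2 <;> rcases k3 with k3 | k3 <;> linarith
  obtain ⟨t, ht, h⟩ := hX.exists_near_sub hγ ht₁ ht ht₂ key
  exact ⟨t, ht, by linarith⟩

/-! ### Broken geodesics -/

/-- The broken path through `y 0, …, y N` has sides of length at least `R` and Gromov products
at most `ω` at the breaking points. -/
structure IsBrokenPath (y : ℕ → X) (N : ℕ) (ω R : ℝ) : Prop where
  long : ∀ i < N, R ≤ dist (y i) (y (i + 1))
  bend : ∀ i, i + 1 < N →
    dist (y i) (y (i + 1)) + dist (y (i + 1)) (y (i + 2)) ≤ dist (y i) (y (i + 2)) + 2 * ω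

namespace IsBrokenPath

variable {y : ℕ → X} {N : ℕ} {ω R : ℝ}

/-- The error does not grow with `j`: the induction hypothesis only excludes one alternative of the
four-point inequality, since the side is long, and the other alternative yields the constant `2 * ω
+ 4` afresh. -/
lemma forward (hX : FourPoint X) (h : IsBrokenPath y N ω R) (hω : 0 ≤ ω) (hR : 2 * ω + 6 < R) :
    ∀ j, j < N →
      dist (y 0) (y j) + dist (y j) (y (j + 1)) ≤ dist (y 0) (y (j + 1)) + 2 * ω + 4 := by
  intro j
  induction j with
  | zero => intro _; simp; linarith
  | succ j ih =>
    intro hj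
    have ih := ih (by omega)
    have h1 := h.long j (by omega)
    have h2 := h.bend j hj
    rcases hX (y j) (y 0) (y (j + 2)) (y (j + 1)) with k | k
    · rw [dist_comm (y j) (y 0), dist_comm (y (j + 2)) (y (j + 1))] at k
      linarith
    · show dist (y 0) (y (j + 1)) + dist (y (j + 1)) (y (j + 2)) ≤ dist (y 0) (y (j + 2)) + _ + _
      linarith

lemma backward (hX : FourPoint X) (h : IsBrokenPath y N ω R) (hω : 0 ≤ ω) (hR : 2 * ω + 6 < R) :
    ∀ k b, b + 1 + k ≤ N →
      dist (y b) (y (b + 1)) + dist (y (b + 1)) (y (b + 1 + k)) ≤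
        dist (y b) (y (b + 1 + k)) + 2 * ω + 4 := by
  intro k
  induction k with
  | zero => intro b _; simp; linarith
  | succ k ih =>
    intro b hb
    have ih := ih (b + 1) (by omega)
    have h1 := h.long (b + 1) (by omega)
    have h2 := h.bend b (by omega)
    have e : b + 1 + (k + 1) = b + 1 + 1 + k := by ring
    rw [e]
    rw [show b + 2 = b + 1 + 1 from rfl] at h2
    rcases hX (y b) (y (b + 1 + 1 + k)) (y (b + 1 + 1)) (y (b + 1)) with h3 | h3
    · rw [dist_comm (y (b + 1 + 1 + k)) (y (b + 1)), dist_comm (y (b + 1 + 1)) (y (b + 1))] at h3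
      linarith
    · rw [dist_comm (y (b + 1 + 1 + k)) (y (b + 1)),
        dist_comm (y (b + 1 + 1 + k)) (y (b + 1 + 1))] at h3
      linarith

/-- The four-point inequality joins the estimates for the initial and the final part of the path at
the vertex `y b`. -/
lemma through (hX : FourPoint X) (h : IsBrokenPath y N ω R) (hω : 0 ≤ ω) (hR : 2 * ω + 6 < R)
    {b : ℕ} (hb : b ≤ N) :
    dist (y 0) (y b) + dist (y b) (y N) ≤ dist (y 0) (y N) + 2 * ω + 8 := by
  rcases hb.eq_or_lt with rfl | hb
  · simp; linarith
  · have h1 := h.forward hX hω hR b hb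
    obtain ⟨k, rfl⟩ := Nat.exists_eq_add_of_lt hb
    have h2 := h.backward hX hω hR k b (by omega)
    have h3 := h.long b hb
    rw [show b + 1 + k = b + k + 1 by ring] at h2
    rcases hX (y 0) (y b) (y (b + 1)) (y (b + k + 1)) with h4 | h4 <;> linarith

lemma lt_dist (hX : FourPoint X) (h : IsBrokenPath y N ω R) (hω : 0 ≤ ω) (hR : 2 * ω + 6 < R)
    {j : ℕ} (hj : j < N) : dist (y 0) (y j) + (R - 2 * ω - 4) ≤ dist (y 0) (y (j + 1)) := by
  linarith [h.forward hX hω hR j hj, h.long j hj]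

lemma sum_le_dist (hX : FourPoint X) (h : IsBrokenPath y N ω R) (hω : 0 ≤ ω)
    (hR : 2 * ω + 6 < R) :
    ∑ j ∈ Finset.range N, (dist (y j) (y (j + 1)) - (2 * ω + 4)) ≤ dist (y 0) (y N) := by
  have : ∀ m ≤ N, ∑ j ∈ Finset.range m, (dist (y j) (y (j + 1)) - (2 * ω + 4)) ≤
      dist (y 0) (y m) := by
    intro m
    induction m with
    | zero => simp
    | succ m ih =>
      intro hm
      rw [Finset.sum_range_succ]
      linarith [ih (by omega), h.forward hX hω hR m (by omega)]
  exact this N le_rfl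

/-- The two end sides of a broken path survive in the distance of its endpoints. -/
lemma ends_le_dist (hX : FourPoint X) (h : IsBrokenPath y N ω R) (hω : 0 ≤ ω)
    (hR : 2 * ω + 6 < R) (hN : 2 ≤ N) :
    dist (y 0) (y 1) + dist (y (N - 1)) (y N) ≤ dist (y 0) (y N) + 2 * ω + 4 := by
  obtain ⟨m, rfl⟩ := Nat.exists_eq_add_of_le hN
  have h1 := h.forward hX hω hR (m + 1) (by omega)
  have h2 : ∀ j, j ≤ m → dist (y 0) (y 1) ≤ dist (y 0) (y (j + 1)) := by
    intro j
    induction j with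
    | zero => simp
    | succ j ih =>
      intro hj
      linarith [ih (by omega), h.lt_dist hX hω hR (j := j + 1) (by omega)]
  have h3 := h2 m le_rfl
  rw [show 2 + m - 1 = m + 1 by omega, show 2 + m = m + 1 + 1 by ring]
  linarith

/-- A short part of a geodesic with the same endpoints as a broken path with long sides lies near
two consecutive sides, as if these formed a geodesic triangle with it. -/
lemma exists_near_bend (hX : FourPoint X) {m : ℕ} (h : IsBrokenPath y (m + 2) ω R) (hω : 0 ≤ ω)
    {Λ : ℝ} (hΛ : 0 ≤ Λ) (hR : Λ + 8 * ω + 100 < R) {γ : ℝ → X}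
    (hγ : IsGeodesicFromTo γ (y 0) (y (m + 2))) {a b : ℝ} (ha : 0 ≤ a)
    (hb : b ≤ dist (y 0) (y (m + 2))) (hab : b - a ≤ Λ) :
    ∃ j ≤ m, ∀ t ∈ Icc a b,
      dist (y j) (γ t) + dist (γ t) (y (j + 2)) ≤ dist (y j) (y (j + 2)) + 12 := by
  have hR' : 2 * ω + 6 < R := by linarith
  -- `y j` is chosen as a last vertex safely before the parameter `a`. As sides exceed `Λ` by a
  -- margin, the whole of `[a, b]` then ends before `y (j + 2)`; at either end of the path no margin
  -- is needed.
  have hex : ∃ j ≤ m, (j = 0 ∨ dist (y 0) (y j) + (2 * ω + 20) ≤ a) ∧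
      (j = m ∨ a < dist (y 0) (y (j + 1)) + (2 * ω + 20)) := by
    have : ∀ k ≤ m, ∃ j ≤ k, (j = 0 ∨ dist (y 0) (y j) + (2 * ω + 20) ≤ a) ∧
        (j = k ∨ a < dist (y 0) (y (j + 1)) + (2 * ω + 20)) := by
      intro k
      induction k with
      | zero => intro _; exact ⟨0, le_rfl, Or.inl rfl, Or.inl rfl⟩
      | succ k ih =>
        intro hk
        obtain ⟨j, hj, h1, h2⟩ := ih (by omega)
        rcases h2 with rfl | h2
        · rcases lt_or_ge a (dist (y 0) (y (j + 1)) + (2 * ω + 20)) with h3 | h3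
          · exact ⟨j, by omega, h1, Or.inr h3⟩
          · exact ⟨j + 1, le_rfl, Or.inr h3, Or.inl rfl⟩
        · exact ⟨j, by omega, h1, Or.inr h2⟩
    exact this m le_rfl
  obtain ⟨j, hj, hl, hr⟩ := hex
  refine ⟨j, hj, fun t ht => ?_⟩
  have htm : t ∈ Icc (0 : ℝ) (dist (y 0) (y (m + 2))) := ⟨ha.trans ht.1, ht.2.trans hb⟩
  have g1 := hγ.dist_left htm
  have g2 := hγ.dist_right htm
  have th1 := h.through hX hω hR' (b := j) (by omega)
  have th2 := h.through hX hω hR' (b := j + 2) (by omega)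
  have i1 := h.lt_dist hX hω hR' (j := j) (by omega)
  have i2 := h.lt_dist hX hω hR' (j := j + 1) (by omega)
  have A : dist (γ t) (y j) ≤ dist (y j) (y (m + 2)) - (dist (y 0) (y (m + 2)) - t) + 4 := by
    rcases hX.dist_le (p := y 0) (q := y (m + 2)) (z := γ t) (ε := 0) (by linarith) (y j)
      with k | k
    · rcases hl with rfl | hl
      · rw [dist_comm, g1]; linarith
      · have := ht.1
        linarith [dist_nonneg (x := γ t) (y := y j)]
    · rw [dist_comm (y (m + 2)), g2] at k
      linarith
  have B : dist (γ t) (y (j + 2)) ≤ dist (y 0) (y (j + 2)) - t + 4 := by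
    rcases hX.dist_le (p := y 0) (q := y (m + 2)) (z := γ t) (ε := 0) (by linarith) (y (j + 2))
      with k | k
    · linarith
    · rcases hr with rfl | hr
      · linarith
      · have := ht.2
        rw [dist_comm (y (m + 2)), g2] at k
        rw [show j + 1 + 1 = j + 2 from rfl] at i2
        linarith [dist_nonneg (x := γ t) (y := y (j + 2))]
  have C := hX (y j) (y 0) (y (m + 2)) (y (j + 2))
  rw [dist_comm (y j) (γ t)]
  rw [dist_comm (y j) (y 0), dist_comm (y (m + 2)) (y (j + 2))] at C
  have D := dist_nonneg (x := y j) (y := y (j + 2))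
  rw [show j + 1 + 1 = j + 2 from rfl] at i2
  rcases C with C | C <;> linarith

end IsBrokenPath

end Geometry

/-! ### Geodesics near an orbit and the Gromov product at the midpoint of an edge -/

section Orbit

variable {G : Type u} {X : Type v} [Group G] [MetricSpace X] [MulAction G X]

/-- Every part of length greater than `d` of a geodesic between points of the orbit `H x` meets the
`B`-neighborhood of that orbit. -/
def OrbitDense (x : X) (H : Subgroup G) (B d : ℝ) : Prop :=
  ∀ u ∈ H, ∀ γ : ℝ → X, IsGeodesicFromTo γ x (u • x) →
    ∀ a b : ℝ, 0 ≤ a → b ≤ dist x (u • x) → d < b - a →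
      ∃ t ∈ Icc a b, ∃ v ∈ H, dist (γ t) (v • x) ≤ B

variable [IsIsometricSMul G X]

/-- Density of the orbit along geodesics passes from orbit endpoints to endpoints within `ρ` of the
orbit. A geodesic that stays away from the orbit can only have left the neighborhoods of its
endpoints and run along `[h x, h' x]`, where the hypothesis provides a close orbit point. -/
lemma OrbitDense.between (hX : IsHyperbolicSpace 1 X) {x : X} {H : Subgroup G} {ρ c d : ℝ}
    (hH : OrbitDense x H (ρ - (c + 68)) d) (hc : 0 ≤ c) (hd : 0 ≤ d) {e e' : X}
    (he : ∃ h ∈ H, dist e (h • x) ≤ ρ) (he' : ∃ h ∈ H, dist e' (h • x) ≤ ρ)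
    {γ : ℝ → X} (hγ : IsGeodesicFromTo γ e e') {a b : ℝ} (ha : 0 ≤ a) (hb : b ≤ dist e e')
    (hab : d + 2 * c + 41 < b - a) :
    ∃ t ∈ Icc a b, ∃ v ∈ H, dist (γ t) (v • x) ≤ ρ - c := by
  have hF := hX.fourPoint
  by_contra! hno
  obtain ⟨h, hh, he⟩ := he
  obtain ⟨h', hh', he'⟩ := he'
  have hnear : ∀ t ∈ Icc (a + c + 4) (b - c - 4),
      dist (h • x) (γ t) + dist (γ t) (h' • x) ≤ dist (h • x) (h' • x) + 12 := by
    intro t ht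
    have htab : t ∈ Icc a b := ⟨by linarith [ht.1], by linarith [ht.2]⟩
    have htm : t ∈ Icc (0 : ℝ) (dist e e') := ⟨ha.trans htab.1, htab.2.trans hb⟩
    have n1 := hno t htab h hh
    have n2 := hno t htab h' hh'
    have g1 := hγ.dist_left htm
    have g2 := hγ.dist_right htm
    have k1 := hF.dist_le (p := e) (q := e') (z := γ t) (ε := 0) (by linarith) (h • x)
    have k2 := hF.dist_le (p := e) (q := e') (z := γ t) (ε := 0) (by linarith) (h' • x)
    have k3 := hF e e' (h' • x) (h • x)
    rw [dist_comm (h' • x) (h • x)] at k3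
    rw [dist_comm (h • x) (γ t)]
    have := ht.1
    have := ht.2
    rcases k1 with k1 | k1
    · linarith
    rcases k2 with k2 | k2
    · rcases k3 with k3 | k3 <;> linarith
    · linarith
  obtain ⟨τ, hτ⟩ := hX.1 x ((h⁻¹ * h') • x)
  have hσ := hτ.smul h
  rw [smul_smul, mul_inv_cancel_left] at hσ
  have hlen : dist (h • x) (h' • x) = dist x ((h⁻¹ * h') • x) := by
    rw [← dist_smul h x, smul_smul, mul_inv_cancel_left]
  have hle : a + c + 4 ≤ b - c - 4 := by linarith
  obtain ⟨s₁, hs₁, k₁⟩ := hF.exists_near hσ (hnear _ ⟨le_rfl, hle⟩)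
  obtain ⟨s₂, hs₂, k₂⟩ := hF.exists_near hσ (hnear _ ⟨hle, le_rfl⟩)
  have hγd : dist (γ (a + c + 4)) (γ (b - c - 4)) = b - c - 4 - (a + c + 4) :=
    hγ.dist_param ⟨by linarith, by linarith⟩ ⟨by linarith, by linarith⟩ hle
  have e3 := hσ.2.2 s₁ hs₁ s₂ hs₂
  simp only [dist_smul] at e3
  have t1 := dist_triangle4 (γ (a + c + 4)) (h • τ s₁) (h • τ s₂) (γ (b - c - 4))
  have t2 := dist_triangle4 (h • τ s₁) (γ (a + c + 4)) (γ (b - c - 4)) (h • τ s₂)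
  rw [dist_smul, e3, dist_comm (h • τ s₂) (γ (b - c - 4))] at t1
  rw [dist_smul, e3, dist_comm (h • τ s₁) (γ (a + c + 4))] at t2
  have hsub : max s₁ s₂ - min s₁ s₂ = |s₁ - s₂| := max_sub_min_eq_abs' s₁ s₂
  rw [hlen] at hs₁ hs₂
  obtain ⟨s, hs, v, hv, hsv⟩ := hH _ (H.mul_mem (H.inv_mem hh) hh') τ hτ (min s₁ s₂) (max s₁ s₂)
    (le_min hs₁.1 hs₂.1) (max_le hs₁.2 hs₂.2) (by rw [hsub]; linarith)
  have hsm : s ∈ Icc (0 : ℝ) (dist (h • x) (h' • x)) := by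
    rw [hlen]
    exact ⟨(le_min hs₁.1 hs₂.1).trans hs.1, hs.2.trans (max_le hs₁.2 hs₂.2)⟩
  have e1 := hσ.2.2 s₁ (by rw [hlen]; exact hs₁) s hsm
  have e2 := hσ.2.2 s hsm s₂ (by rw [hlen]; exact hs₂)
  simp only at e1 e2
  have hadd : |s₁ - s| + |s - s₂| = |s₁ - s₂| := by
    obtain ⟨q1, q2⟩ := hs
    rcases le_total s₁ s₂ with q | q
    · rw [min_eq_left q] at q1
      rw [max_eq_right q] at q2
      rw [abs_of_nonpos, abs_of_nonpos, abs_of_nonpos] <;> linarith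
    · rw [min_eq_right q] at q1
      rw [max_eq_left q] at q2
      rw [abs_of_nonneg, abs_of_nonneg, abs_of_nonneg] <;> linarith
  have t3 := dist_triangle (γ (a + c + 4)) (h • τ s₁) (h • τ s)
  have t4 := dist_triangle (h • τ s) (h • τ s₂) (γ (b - c - 4))
  rw [dist_comm (h • τ s₂) (γ (b - c - 4))] at t4
  -- The two ends are `16`-close, and each closeness is used twice, whence `64`; returning to `γ`
  -- costs `64 + 4 = 68`, the loss built into `hH`.
  obtain ⟨t, ht, k⟩ := hF.exists_near_sub hγ (z := h • τ s) (ε := 64) (a := a + c + 4)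
    (b := b - c - 4) (by linarith) hle (by linarith)
    (by linarith)
  have n := hno t ⟨by linarith [ht.1], by linarith [ht.2]⟩ (h * v) (H.mul_mem hh hv)
  have t5 := dist_triangle (γ t) (h • τ s) ((h * v) • x)
  rw [mul_smul, dist_smul, dist_comm (γ t) (h • τ s)] at t5
  rw [mul_smul] at n
  linarith

/-- If `g` is almost shortest in its double coset `H g H` and geodesics with endpoints in `H x`
come close to `H x` often enough, then the Gromov product at `m` of a point `e` near `H x` and a
point `f` near `g H x` is bounded, where `m` is near both. -/
lemma OrbitDense.gromov_bounded (hX : IsHyperbolicSpace 1 X) {x : X} {H : Subgroup G} {g : G}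
    {d d' : ℝ} (hd : 0 ≤ d) (hd' : 0 ≤ d')
    (hH : OrbitDense x H (disp x g / 2 - (1 + 68)) d)
    (hH' : OrbitDense x H (disp x g / 2 - (d + 53 + 68)) d')
    (hmin : ∀ h ∈ H, ∀ h' ∈ H, disp x g - 1 ≤ dist (h • x) (g • h' • x))
    {e f m : X} (he : ∃ h ∈ H, dist e (h • x) ≤ disp x g / 2)
    (hf : ∃ h ∈ H, dist f (g • h • x) ≤ disp x g / 2)
    (hm : ∃ h ∈ H, dist m (h • x) ≤ disp x g / 2)
    (hm' : ∃ h ∈ H, dist m (g • h • x) ≤ disp x g / 2) :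
    dist e m + dist m f ≤ dist e f + 2 * (3 * d + d' + 300) := by
  have hF := hX.fourPoint
  by_contra! hlt
  set ω := 3 * d + d' + 300 with hω
  obtain ⟨γ, hγ⟩ := hX.1 m e
  obtain ⟨β, hβ⟩ := hX.1 m f
  have t1 := dist_triangle m e f
  have t2 := dist_triangle e f m
  rw [dist_comm m e] at t1
  rw [dist_comm f m] at t2
  have hωe : ω ≤ dist m e := by rw [dist_comm m e]; linarith
  have hωf : ω ≤ dist m f := by linarith
  have hclose : ∀ t ∈ Icc 0 ω, dist (γ t) (β t) ≤ 8 := by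
    intro t ht
    have ht1 : t ∈ Icc 0 (dist m e) := ⟨ht.1, ht.2.trans hωe⟩
    have ht2 : t ∈ Icc 0 (dist m f) := ⟨ht.1, ht.2.trans hωf⟩
    have a1 := hγ.dist_left ht1
    have a2 := hγ.dist_right ht1
    have b1 := hβ.dist_left ht2
    have b2 := hβ.dist_right ht2
    have k1 := hF.dist_le (p := m) (q := e) (z := γ t) (ε := 0) (by linarith) f
    have k2 := hF.dist_le (p := m) (q := f) (z := β t) (ε := 0) (by linarith) (γ t)
    rw [dist_comm (β t) (γ t), dist_comm f (γ t)] at k2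
    rw [a2, dist_comm m e] at k1
    have := ht.2
    rcases k1 with k1 | k1 <;> rcases k2 with k2 | k2 <;> linarith
  -- The gain `d + 53` on this side must pay for the gap `d + 44` until the other geodesic comes
  -- near its orbit, and for the distance `8` between the geodesics.
  obtain ⟨t₀, ht₀, v, hv, k₀⟩ := OrbitDense.between hX hH' (by linarith) hd' hm he hγ
    (a := d + 44) (b := ω) (by linarith) hωe (by rw [hω]; linarith)
  have hβ' := hβ.smul g⁻¹
  have conv : ∀ z : X, (∃ h ∈ H, dist z (g • h • x) ≤ disp x g / 2) →
      ∃ h ∈ H, dist (g⁻¹ • z) (h • x) ≤ disp x g / 2 := by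
    rintro z ⟨h, hh, hz⟩
    refine ⟨h, hh, ?_⟩
    rwa [← dist_smul g, smul_inv_smul]
  obtain ⟨t₁, ht₁, v', hv', k₁⟩ := OrbitDense.between hX hH (by norm_num) hd (conv m hm')
    (conv f hf) hβ' (a := t₀ - (d + 44)) (b := t₀) (by linarith [ht₀.1])
    (by rw [dist_smul]; exact ht₀.2.trans hωf) (by linarith)
  rw [← dist_smul g, smul_inv_smul] at k₁
  have c₀ := hclose t₀ ⟨by linarith [ht₀.1], ht₀.2⟩
  have c₁ := hβ.dist_param (s := t₁) (t := t₀) ⟨by linarith [ht₀.1, ht₁.1],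
    by linarith [ht₀.2, ht₁.2]⟩ ⟨by linarith [ht₀.1], by linarith [ht₀.2]⟩ ht₁.2
  -- The path from `v x` to `g v' x` has length at most `(|g|/2 - (d + 53)) + 8 + (d + 44) + (|g|/2
  -- - 1) = |g| - 2`, against the lower bound `|g| - 1`.
  have n := hmin v hv v' hv'
  have t3 := dist_triangle4 (v • x) (γ t₀) (β t₀) (g • v' • x)
  have t4 := dist_triangle (β t₀) (β t₁) (g • v' • x)
  rw [dist_comm (v • x) (γ t₀)] at t3
  rw [dist_comm (β t₀) (β t₁)] at t4
  have := ht₁.1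
  linarith

end Orbit

/-! ### Breaking points of an alternating product -/

section AltPoint

variable {G : Type u} {X : Type v} [Group G] [MulAction G X]

/-- The point of a segment `[x, g^{±1} x]` corresponding to the point `m` of `[x, g x]`. -/
def edgeMid (g : G) (m : X) (ε : ℤˣ) : X := if ε = 1 then m else g⁻¹ • m

/-- The breaking points of the broken path of an alternating product of `l` letters `g^{±1}`: the
base-point, the midpoints of the translates of `[x, g^{±1} x]`, and the translated base-point. -/
def altPoint (x : X) (g : G) (m : X) (h : ℕ → G) (ε : ℕ → ℤˣ) (l : ℕ) : ℕ → X
  | 0 => x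
  | i + 1 => if i < l then (altPrefix g h ε i * h i) • edgeMid g m (ε i)
      else (altPrefix g h ε l * h l) • x

lemma zpow_smul_edgeMid_neg (g : G) (m : X) (ε : ℤˣ) :
    g ^ ((ε : ℤˣ) : ℤ) • edgeMid g m (-ε) = edgeMid g m ε := by
  rcases Int.units_eq_one_or ε with rfl | rfl
  · simp [edgeMid, show (-1 : ℤˣ) ≠ 1 by decide]
  · simp [edgeMid, show (-1 : ℤˣ) ≠ 1 by decide]

variable {x m : X} {g : G} {h : ℕ → G} {ε : ℕ → ℤˣ} {l : ℕ}

lemma altPoint_succ_of_lt {i : ℕ} (hi : i < l) :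
    altPoint x g m h ε l (i + 1) = (altPrefix g h ε i * h i) • edgeMid g m (ε i) := by
  simp [altPoint, hi]

/-- The same midpoint seen from the far end of its edge, where the edge is traversed in the opposite
direction. This form is used for the side that starts at the midpoint. -/
lemma altPoint_succ_of_lt' {i : ℕ} (hi : i < l) :
    altPoint x g m h ε l (i + 1) = altPrefix g h ε (i + 1) • edgeMid g m (-(ε i)) := by
  rw [altPoint_succ_of_lt hi, altPrefix, mul_smul _ (g ^ _), zpow_smul_edgeMid_neg]

lemma altPoint_last : altPoint x g m h ε l (l + 1) = (altPrefix g h ε l * h l) • x := by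
  simp [altPoint]

end AltPoint

/-! ### The broken path of an alternating product -/

section Alternating

variable {G : Type u} {X : Type v} [Group G] [MetricSpace X] [MulAction G X]

/-- The point `m` is a midpoint of `[x, g x]`, the element `g` is almost shortest in `H g H`, the
nontrivial elements of `H` and the elements of `g H` move all points far, and the Gromov products
at `m` of points near `H x` and points near `g H x` are bounded by `ω`. -/
structure IsEdge (x : X) (H : Subgroup G) (g : G) (m : X) (ω R : ℝ) : Prop where
  mid : dist x m = disp x g / 2
  mid' : dist m (g • x) = disp x g / 2
  minimal : ∀ h ∈ H, ∀ h' ∈ H, disp x g - 1 ≤ dist (h • x) (g • h' • x)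
  gromov : ∀ e f : X, (∃ h ∈ H, dist e (h • x) ≤ disp x g / 2) →
    (∃ h ∈ H, dist f (g • h • x) ≤ disp x g / 2) →
    dist e m + dist m f ≤ dist e f + 2 * ω
  moves : ∀ h ∈ H, h ≠ 1 → ∀ y : X, R ≤ dist y (h • y)
  moves' : ∀ h ∈ H, ∀ y : X, R ≤ dist y (g • h • y)
  long : R ≤ disp x g / 2 - 1

variable [IsIsometricSMul G X]

namespace IsEdge

variable {x m : X} {H : Subgroup G} {g : G} {ω R : ℝ}

lemma dist_edgeMid (E : IsEdge x H g m ω R) (ε : ℤˣ) :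
    dist (edgeMid g m ε) x = disp x g / 2 := by
  rcases Int.units_eq_one_or ε with rfl | rfl
  · simpa [edgeMid, dist_comm] using E.mid
  · simp only [edgeMid, show (-1 : ℤˣ) ≠ 1 by decide, if_false]
    rw [← dist_smul g, smul_inv_smul]
    exact E.mid'

lemma gromov_edgeMid (E : IsEdge x H g m ω R) (ε : ℤˣ) {e f : X}
    (he : ∃ h ∈ H, dist e (h • x) ≤ disp x g / 2)
    (hf : ∃ h ∈ H, dist f (g ^ ((ε : ℤˣ) : ℤ) • h • x) ≤ disp x g / 2) :
    dist e (edgeMid g m ε) + dist (edgeMid g m ε) f ≤ dist e f + 2 * ω := by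
  rcases Int.units_eq_one_or ε with rfl | rfl
  · simpa [edgeMid] using E.gromov e f he (by simpa using hf)
  · have hc : dist (g • f) m + dist m (g • e) ≤ dist (g • f) (g • e) + 2 * ω := by
      refine E.gromov (g • f) (g • e) ?_ ?_
      · obtain ⟨h, hh, hf⟩ := hf
        refine ⟨h, hh, ?_⟩
        rw [← dist_smul g] at hf
        simpa using hf
      · obtain ⟨h, hh, he⟩ := he
        exact ⟨h, hh, by rwa [dist_smul]⟩
    simp only [edgeMid, show (-1 : ℤˣ) ≠ 1 by decide, if_false]
    rw [← dist_smul g e, ← dist_smul g _ f, ← dist_smul g e f, smul_inv_smul,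
      dist_comm (g • e) m, dist_comm m (g • f), dist_comm (g • e) (g • f)]
    linarith

/-- From the midpoint half of |g| suffices to complete an element of HgH, so a closer orbit point of
H would contradict almost minimality of g. -/
lemma le_dist_edgeMid (E : IsEdge x H g m ω R) (ε : ℤˣ) {h : G} (hh : h ∈ H) :
    disp x g / 2 - 1 ≤ dist (h • x) (edgeMid g m ε) := by
  rcases Int.units_eq_one_or ε with rfl | rfl
  · have h1 := E.minimal h hh 1 H.one_mem
    have h2 := dist_triangle (h • x) m (g • x)
    rw [one_smul] at h1
    rw [E.mid'] at h2
    simp only [edgeMid, if_true]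
    linarith
  · have h1 := E.minimal 1 H.one_mem h hh
    have h2 := dist_triangle x m (g • h • x)
    rw [one_smul] at h1
    rw [E.mid] at h2
    simp only [edgeMid, show (-1 : ℤˣ) ≠ 1 by decide, if_false]
    rw [← dist_smul g, smul_inv_smul, dist_comm]
    linarith

/-- Two consecutive midpoints differ by an element of H when the exponents are opposite, and by an
element of gH or the inverse of a conjugate of one when they agree. The nontriviality condition on
`h` is needed only in the first case. -/
lemma le_dist_edgeMid_edgeMid (E : IsEdge x H g m ω R) (δ ε : ℤˣ) {h : G} (hh : h ∈ H)
    (hne : δ = -ε → h ≠ 1) : R ≤ dist (edgeMid g m (-δ)) (h • edgeMid g m ε) := by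
  rcases Int.units_eq_one_or δ with rfl | rfl <;> rcases Int.units_eq_one_or ε with rfl | rfl
  · simp only [edgeMid, show (-1 : ℤˣ) ≠ 1 by decide, if_false, if_true]
    rw [← dist_smul g, smul_inv_smul]
    exact E.moves' h hh m
  · simp only [edgeMid, show (-1 : ℤˣ) ≠ 1 by decide, if_false]
    exact E.moves h hh (hne (by decide)) _
  · simp only [edgeMid, neg_neg, if_true]
    exact E.moves h hh (hne (by decide)) _
  · simp only [edgeMid, neg_neg, show (-1 : ℤˣ) ≠ 1 by decide, if_false, if_true]
    have := E.moves' h⁻¹ (H.inv_mem hh) m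
    rw [← dist_smul (h * g⁻¹)] at this
    simp only [mul_smul, inv_smul_smul, smul_inv_smul] at this
    rwa [dist_comm]

variable {h : ℕ → G} {ε : ℕ → ℤˣ} {l : ℕ}

lemma dist_altPoint (E : IsEdge x H g m ω R) {i : ℕ} (hi : i < l) :
    dist (altPrefix g h ε (i + 1) • x) (altPoint x g m h ε l (i + 1)) = disp x g / 2 := by
  rw [altPoint_succ_of_lt' hi, dist_smul, dist_comm, E.dist_edgeMid]

lemma dist_altPoint' (E : IsEdge x H g m ω R) {i : ℕ} (hi : i < l) :
    dist ((altPrefix g h ε i * h i) • x) (altPoint x g m h ε l (i + 1)) = disp x g / 2 := by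
  rw [altPoint_succ_of_lt hi, dist_smul, dist_comm, E.dist_edgeMid]

lemma dist_altPoint_le (E : IsEdge x H g m ω R) {i : ℕ} (hi : i ≤ l) :
    dist (altPoint x g m h ε l i) (altPrefix g h ε i • x) ≤ disp x g / 2 := by
  cases i with
  | zero => simp [altPoint, altPrefix, disp]; positivity
  | succ i => rw [dist_comm, E.dist_altPoint hi]

lemma dist_altPoint_le' (E : IsEdge x H g m ω R) {i : ℕ} (hi : i ≤ l) :
    dist (altPoint x g m h ε l (i + 1)) ((altPrefix g h ε i * h i) • x) ≤ disp x g / 2 := by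
  rcases hi.eq_or_lt with rfl | hi
  · simp [altPoint, disp]; positivity
  · rw [dist_comm, E.dist_altPoint' hi]

lemma le_dist_altPoint_first (E : IsEdge x H g m ω R) (hl : 0 < l) (h0 : h 0 ∈ H) :
    disp x g / 2 - 1 ≤ dist (altPoint x g m h ε l 0) (altPoint x g m h ε l 1) := by
  rw [show altPoint x g m h ε l 1 = _ from altPoint_succ_of_lt hl]
  have := E.le_dist_edgeMid (ε 0) (H.inv_mem h0)
  rw [← dist_smul (h 0), smul_inv_smul] at this
  simpa [altPoint, altPrefix] using this

lemma le_dist_altPoint_last (E : IsEdge x H g m ω R) (hl : 0 < l) (h0 : h l ∈ H) :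
    disp x g / 2 - 1 ≤ dist (altPoint x g m h ε l l) (altPoint x g m h ε l (l + 1)) := by
  obtain ⟨k, rfl⟩ := Nat.exists_eq_succ_of_ne_zero hl.ne'
  rw [altPoint_last, Nat.succ_eq_add_one, altPoint_succ_of_lt' (by omega), mul_smul, dist_smul,
    dist_comm]
  exact E.le_dist_edgeMid _ h0

/-- Inner sides are long because elements move points far, the two end sides because of almost
minimality. At a midpoint the neighboring vertices lie near the two orbits joined by the edge, so
`gromov` bounds the bend. -/
lemma isBrokenPath (E : IsEdge x H g m ω R) (hl : 0 < l) (hH : ∀ i ≤ l, h i ∈ H)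
    (hne : ∀ i, i + 1 < l → ε i = -ε (i + 1) → h (i + 1) ≠ 1) :
    IsBrokenPath (altPoint x g m h ε l) (l + 1) ω R := by
  constructor
  · intro i hi
    rcases Nat.eq_zero_or_pos i with rfl | hi0
    · exact E.long.trans (E.le_dist_altPoint_first hl (hH 0 hl.le))
    rcases (Nat.lt_succ_iff.1 hi).eq_or_lt with rfl | hi
    · exact E.long.trans (E.le_dist_altPoint_last hl (hH _ le_rfl))
    obtain ⟨k, rfl⟩ := Nat.exists_eq_succ_of_ne_zero hi0.ne'
    rw [Nat.succ_eq_add_one] at *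
    rw [altPoint_succ_of_lt' (by omega), altPoint_succ_of_lt hi, mul_smul, dist_smul]
    exact E.le_dist_edgeMid_edgeMid _ _ (hH _ hi.le) (hne k hi)
  · intro i hi
    have hil : i < l := by omega
    rw [altPoint_succ_of_lt hil]
    have key := E.gromov_edgeMid (ε i) (e := (altPrefix g h ε i * h i)⁻¹ • altPoint x g m h ε l i)
      (f := (altPrefix g h ε i * h i)⁻¹ • altPoint x g m h ε l (i + 2)) ?_ ?_
    · rwa [← dist_smul (altPrefix g h ε i * h i), smul_inv_smul,
        ← dist_smul (altPrefix g h ε i * h i) (edgeMid g m (ε i)), smul_inv_smul,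
        ← dist_smul (altPrefix g h ε i * h i) (_⁻¹ • _), smul_inv_smul, smul_inv_smul] at key
    · refine ⟨(h i)⁻¹, H.inv_mem (hH i hil.le), ?_⟩
      rw [← dist_smul (altPrefix g h ε i * h i), smul_inv_smul, ← mul_smul, mul_inv_cancel_right]
      exact E.dist_altPoint_le hil.le
    · refine ⟨h (i + 1), hH _ hil, ?_⟩
      rw [← dist_smul (altPrefix g h ε i * h i), smul_inv_smul, ← mul_smul, ← mul_smul]
      exact E.dist_altPoint_le' hil

end IsEdge

end Alternating

/-! ### Factor segments near a geodesic and the tracking property -/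

section Pieces

variable {G : Type u} {X : Type v} [Group G] [MetricSpace X] [MulAction G X]

/-- The point `z` lies on the translate `p [x, k x]` up to an error of `δ`. -/
def AlmostOn (x : X) (p k : G) (δ : ℝ) (z : X) : Prop :=
  dist (p • x) z + dist z ((p * k) • x) ≤ disp x k + δ

/-- The translating element of a segment of the path of an alternating product; the index
`(true, i)` refers to the `i`-th letter `g^{±1}`, the index `(false, i)` to the factor `h i`. -/
def pieceStart (g : G) (h : ℕ → G) (ε : ℕ → ℤˣ) (c : Bool × ℕ) : G :=
  if c.1 then altPrefix g h ε c.2 * h c.2 else altPrefix g h ε c.2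

/-- The factor of an alternating product with the given index. -/
def pieceElt (g : G) (h : ℕ → G) (ε : ℕ → ℤˣ) (c : Bool × ℕ) : G :=
  if c.1 then g ^ ((ε c.2 : ℤˣ) : ℤ) else h c.2

/-- The indices of the factors of an alternating product with `l` letters `g^{±1}`. -/
def IsPieceIndex (l : ℕ) (c : Bool × ℕ) : Prop := if c.1 then c.2 < l else c.2 ≤ l

lemma AlmostOn.of_dist_le {x : X} {p k : G} {δ η : ℝ} {z z' : X} (h : AlmostOn x p k δ z)
    (hz : dist z' z ≤ η) : AlmostOn x p k (δ + 2 * η) z' := by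
  have h1 := dist_triangle (p • x) z z'
  have h2 := dist_triangle z' z ((p * k) • x)
  rw [dist_comm z z'] at h1
  unfold AlmostOn at *
  linarith

lemma AlmostOn.mono {x : X} {p k : G} {δ δ' : ℝ} {z : X} (h : AlmostOn x p k δ z)
    (hd : δ ≤ δ') : AlmostOn x p k δ' z := by
  unfold AlmostOn at *
  linarith

variable [IsIsometricSMul G X]

lemma disp_inv (x : X) (g : G) : disp x g⁻¹ = disp x g := by
  rw [disp, disp, ← dist_smul g, smul_inv_smul, dist_comm]

lemma disp_zpow_units (x : X) (g : G) (ε : ℤˣ) : disp x (g ^ ((ε : ℤˣ) : ℤ)) = disp x g := by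
  rcases Int.units_eq_one_or ε with rfl | rfl
  · simp
  · simp [disp_inv]

lemma dist_smul_smul_mul (x : X) (p k : G) : dist (p • x) ((p * k) • x) = disp x k := by
  rw [mul_smul, dist_smul, disp]

lemma AlmostOn.smul {x : X} {p k : G} {δ : ℝ} {z : X} (h : AlmostOn x p k δ z) (q : G) :
    AlmostOn x (q * p) k δ (q • z) := by
  unfold AlmostOn at *
  rwa [mul_smul, dist_smul, mul_assoc, mul_smul, dist_smul]

/-- If two points of a geodesic at distance at least `3 T / 2` lie almost on `p [x, k x]`, then
`p [x, k x]` has a subsegment of length `T` near the part of the geodesic between them. -/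
lemma nearPieceOf_of_almostOn (hF : FourPoint X) {x : X} {p k : G} {γ : ℝ → X} {q q' : X}
    (hγ : IsGeodesicFromTo γ q q') {a b t₁ t₂ r T : ℝ} (ha : 0 ≤ a) (hb : b ≤ dist q q')
    (ht₁ : t₁ ∈ Icc a b) (ht₂ : t₂ ∈ Icc a b) (hT : 1000 ≤ T) (hr : 16 ≤ r)
    (ht : 3 / 2 * T ≤ t₂ - t₁) (h₁ : AlmostOn x p k 24 (γ t₁)) (h₂ : AlmostOn x p k 24 (γ t₂)) :
    NearPieceOf x γ a b r T p k := by
  intro β hβ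
  have hβ' := hβ.smul p
  rw [smul_smul] at hβ'
  have hlen : dist (p • x) ((p * k) • x) = dist x (k • x) := by rw [mul_smul, dist_smul]
  obtain ⟨s₁, hs₁, k₁⟩ := hF.exists_near hβ' (z := γ t₁) (ε := 24) (by rw [hlen]; exact h₁)
  obtain ⟨s₂, hs₂, k₂⟩ := hF.exists_near hβ' (z := γ t₂) (ε := 24) (by rw [hlen]; exact h₂)
  have e := hβ'.2.2 s₁ hs₁ s₂ hs₂
  have hd := hγ.dist_param (s := t₁) (t := t₂) ⟨ha.trans ht₁.1, ht₁.2.trans hb⟩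
    ⟨ha.trans ht₂.1, ht₂.2.trans hb⟩ (by linarith)
  have t4 := dist_triangle4 (γ t₁) (p • β s₁) (p • β s₂) (γ t₂)
  rw [dist_comm (p • β s₂) (γ t₂)] at t4
  have hsub : max s₁ s₂ - min s₁ s₂ = |s₁ - s₂| := max_sub_min_eq_abs' s₁ s₂
  refine ⟨min s₁ s₂ + 33, max s₁ s₂ - 33, ?_, ?_, ?_, fun s hs => ?_⟩
  · linarith [le_min hs₁.1 hs₂.1]
  · rw [← hlen]; linarith [max_le hs₁.2 hs₂.2]
  · simp only at e; linarith
  · obtain ⟨t, ht, h⟩ := hF.fellow_travel hγ hβ' (ha.trans ht₁.1) (by linarith)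
      (ht₂.2.trans hb) hs₁ hs₂ (by linarith) (by linarith) hs.1 hs.2
    exact ⟨t, ⟨ht₁.1.trans ht.1, ht.2.trans ht₂.2⟩, h.trans hr⟩

namespace IsEdge

variable {x m : X} {H : Subgroup G} {g : G} {ω R : ℝ} {h : ℕ → G} {ε : ℕ → ℤˣ} {l : ℕ}

/-- The indices of the pieces near the broken side `[y i, y (i + 1)]`. -/
lemma almostOn_of_side (hF : FourPoint X) (E : IsEdge x H g m ω R) {i : ℕ} (hi : i ≤ l) {z : X}
    (hz : dist (altPoint x g m h ε l i) z + dist z (altPoint x g m h ε l (i + 1)) ≤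
      dist (altPoint x g m h ε l i) (altPoint x g m h ε l (i + 1)) + 16) :
    (0 < i ∧ AlmostOn x (pieceStart g h ε (true, i - 1)) (pieceElt g h ε (true, i - 1)) 24 z) ∨
    AlmostOn x (pieceStart g h ε (false, i)) (pieceElt g h ε (false, i)) 24 z ∨
    (i < l ∧ AlmostOn x (pieceStart g h ε (true, i)) (pieceElt g h ε (true, i)) 24 z) := by
  simp only [pieceStart, pieceElt, if_true, Bool.false_eq_true, if_false, AlmostOn]
  have hq : dist (altPrefix g h ε i • x) ((altPrefix g h ε i * h i) • x) = disp x (h i) :=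
    dist_smul_smul_mul _ _ _
  -- The side joins two midpoints through two orbit points. Splitting at both leaves half an edge,
  -- the segment of `h i`, and another half edge, at the cost `16 + 4 + 4 = 24`.
  rcases hF.split hz ((altPrefix g h ε i * h i) • x) with k | k
  · rcases hF.split k (altPrefix g h ε i • x) with k | k
    · rcases Nat.eq_zero_or_pos i with rfl | hi0
      · right; left
        rw [show altPoint x g m h ε l 0 = altPrefix g h ε 0 • x by simp [altPoint, altPrefix],
          dist_self] at k
        have t := dist_triangle z (altPrefix g h ε 0 • x) ((altPrefix g h ε 0 * h 0) • x)
        linarith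
      · left
        refine ⟨hi0, ?_⟩
        obtain ⟨j, rfl⟩ := Nat.exists_eq_succ_of_ne_zero hi0.ne'
        simp only [Nat.succ_eq_add_one, Nat.add_sub_cancel] at *
        have e1 := E.dist_altPoint (h := h) (ε := ε) hi
        have e2 := E.dist_altPoint' (h := h) (ε := ε) hi
        have t := dist_triangle ((altPrefix g h ε j * h j) • x) (altPoint x g m h ε l (j + 1)) z
        rw [show altPrefix g h ε j * h j * g ^ ((ε j : ℤˣ) : ℤ) = altPrefix g h ε (j + 1) from rfl,
          disp_zpow_units]
        rw [dist_comm _ (altPrefix g h ε (j + 1) • x)] at k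
        rw [dist_comm z (altPrefix g h ε (j + 1) • x)] at *
        rw [dist_comm (altPoint x g m h ε l (j + 1)) (altPrefix g h ε (j + 1) • x)] at k
        linarith
    · right; left
      linarith
  · rcases hi.eq_or_lt with rfl | hi
    · right; left
      rw [altPoint_last, dist_self] at k
      have t := dist_triangle (altPrefix g h ε i • x) ((altPrefix g h ε i * h i) • x) z
      linarith
    · right; right
      refine ⟨hi, ?_⟩
      have e1 := E.dist_altPoint (h := h) (ε := ε) hi
      have e2 := E.dist_altPoint' (h := h) (ε := ε) hi
      have t := dist_triangle z (altPoint x g m h ε l (i + 1)) (altPrefix g h ε (i + 1) • x)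
      rw [show altPrefix g h ε i * h i * g ^ ((ε i : ℤˣ) : ℤ) = altPrefix g h ε (i + 1) from rfl,
        disp_zpow_units]
      rw [dist_comm (altPoint x g m h ε l (i + 1))] at t
      linarith

/-- A short part of a geodesic `[x, w x]`, where `w` is an alternating product, is covered by the
neighborhoods of five pieces. -/
lemma exists_pieces (hF : FourPoint X) (E : IsEdge x H g m ω R) (hl : 0 < l)
    (hH : ∀ i ≤ l, h i ∈ H) (hne : ∀ i, i + 1 < l → ε i = -ε (i + 1) → h (i + 1) ≠ 1)
    (hω : 0 ≤ ω) {Λ : ℝ} (hΛ : 0 ≤ Λ) (hR : Λ + 8 * ω + 100 < R) {γ : ℝ → X}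
    (hγ : IsGeodesicFromTo γ x ((altPrefix g h ε l * h l) • x)) {a b : ℝ} (ha : 0 ≤ a)
    (hb : b ≤ dist x ((altPrefix g h ε l * h l) • x)) (hab : b - a ≤ Λ) :
    ∃ c : Fin 5 → Bool × ℕ, (∀ k, IsPieceIndex l (c k)) ∧ ∀ t ∈ Icc a b, ∃ k,
      AlmostOn x (pieceStart g h ε (c k)) (pieceElt g h ε (c k)) 24 (γ t) := by
  have hB := E.isBrokenPath hl hH hne
  obtain ⟨n, rfl⟩ := Nat.exists_eq_succ_of_ne_zero hl.ne'
  simp only [Nat.succ_eq_add_one] at *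
  have h0 : altPoint x g m h ε (n + 1) 0 = x := rfl
  have hlast : altPoint x g m h ε (n + 1) (n + 2) = _ := altPoint_last
  obtain ⟨j, hj, hnear⟩ := hB.exists_near_bend hF hω hΛ hR (γ := γ) (a := a) (b := b)
    (by rw [h0, hlast]; exact hγ) ha (by rw [h0, hlast]; exact hb) hab
  -- Two consecutive sides meet three pieces each and share the middle edge, which leaves five. At
  -- the ends of the word a missing edge is replaced by a dummy index.
  refine ⟨![if j = 0 then (false, 0) else (true, j - 1), (false, j), (true, j), (false, j + 1),
    if j + 1 < n + 1 then (true, j + 1) else (false, n + 1)], ?_, fun t ht => ?_⟩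
  · intro k
    fin_cases k <;> simp [IsPieceIndex]
    · by_cases hj0 : j = 0 <;> simp [hj0]; omega
    · omega
    · omega
    · omega
    · by_cases hj1 : j < n <;> simp [hj1]
  · have hsplit := hF.split (hnear t ht) (altPoint x g m h ε (n + 1) (j + 1))
    norm_num at hsplit
    rcases hsplit with k | k
    · rcases E.almostOn_of_side hF (by omega) k with ⟨hj0, k⟩ | k | ⟨-, k⟩
      · exact ⟨0, by simpa [hj0.ne'] using k⟩
      · exact ⟨1, k⟩
      · exact ⟨2, k⟩
    · rcases E.almostOn_of_side hF (i := j + 1) (by omega) k with ⟨-, k⟩ | k | ⟨hj', k⟩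
      · exact ⟨2, k⟩
      · exact ⟨3, k⟩
      · exact ⟨4, by simpa [hj'] using k⟩

lemma alternatingProductsTrack (hF : FourPoint X) (E : IsEdge x H g m ω R) (hω : 0 ≤ ω)
    {r T : ℝ} (hT : 1000 ≤ T) (hr : 16 ≤ r) (hR : 10 * T + 8 * ω + 100 < R) :
    AlternatingProductsTrack x H g r T := by
  intro l h ε hH hne γ hγ a b ha hb hab
  have key : ∃ c : Bool × ℕ, IsPieceIndex l c ∧
      NearPieceOf x γ a b r T (pieceStart g h ε c) (pieceElt g h ε c) := by
    rcases Nat.eq_zero_or_pos l with rfl | hl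
    · refine ⟨(false, 0), by simp [IsPieceIndex], ?_⟩
      have : ∀ t ∈ Icc a b, AlmostOn x (pieceStart g h ε (false, 0)) (pieceElt g h ε (false, 0))
          24 (γ t) := by
        intro t ht
        have htm : t ∈ Icc (0 : ℝ) (dist x ((altPrefix g h ε 0 * h 0) • x)) :=
          ⟨ha.trans ht.1, ht.2.trans hb⟩
        have h1 := hγ.dist_left htm
        have h2 := hγ.dist_right htm
        simp only [AlmostOn, pieceStart, pieceElt, Bool.false_eq_true, if_false, altPrefix,
          one_smul, one_mul, disp] at *
        linarith
      exact nearPieceOf_of_almostOn hF hγ ha hb (t₁ := a) (t₂ := b) ⟨le_rfl, by linarith⟩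
        ⟨by linarith, le_rfl⟩ hT hr (by linarith) (this _ ⟨le_rfl, by linarith⟩)
        (this _ ⟨by linarith, le_rfl⟩)
    · obtain ⟨c, hc, hcov⟩ := E.exists_pieces hF hl hH hne hω (by linarith) hR hγ
        (a := a) (b := a + 10 * T) ha (by linarith) (by linarith)
      -- Six gaps of `3 / 2 * T` fit into `10 * T`, and seven points on five pieces force a
      -- coincidence.
      have hpt : ∀ k : Fin 7, a + 3 / 2 * T * (k : ℕ) ∈ Icc a (a + 10 * T) := by
        intro k
        have h1 : ((k : ℕ) : ℝ) ≤ 6 := by exact_mod_cast Nat.lt_succ_iff.1 k.2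
        have h2 : (0 : ℝ) ≤ ((k : ℕ) : ℝ) := Nat.cast_nonneg _
        constructor <;> nlinarith
      choose f hf using fun k : Fin 7 => hcov _ (hpt k)
      obtain ⟨k, k', hkk, hfk⟩ := Fintype.exists_ne_map_eq_of_card_lt f (by simp)
      wlog hlt : k < k' generalizing k k'
      · exact this k' k hkk.symm hfk.symm (lt_of_le_of_ne (not_lt.1 hlt) hkk.symm)
      refine ⟨c (f k), hc _, ?_⟩
      have hsub : Icc a (a + 10 * T) ⊆ Icc a b := Icc_subset_Icc_right (by linarith)
      refine nearPieceOf_of_almostOn hF hγ ha hb (hsub (hpt k)) (hsub (hpt k')) hT hr ?_ (hf k)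
        (by rw [hfk]; exact hf k')
      have : ((k : ℕ) : ℝ) + 1 ≤ (k' : ℕ) := by exact_mod_cast hlt
      nlinarith
  obtain ⟨⟨b', i⟩, hc, hN⟩ := key
  cases b'
  · exact Or.inr ⟨i, by simpa [IsPieceIndex] using hc, by simpa [pieceStart, pieceElt] using hN⟩
  · exact Or.inl ⟨i, by simpa [IsPieceIndex] using hc, by simpa [pieceStart, pieceElt] using hN⟩

end IsEdge

end Pieces

/-! ### Nielsen moves -/

section Nielsen

variable {G : Type u} [Group G] {n : ℕ}

lemma NielsenEquiv.trans {M M' M'' : Fin n → G} (h : NielsenEquiv M M')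
    (h' : NielsenEquiv M' M'') : NielsenEquiv M M'' := Relation.ReflTransGen.trans h h'

lemma NielsenMove.equiv {M M' : Fin n → G} (h : NielsenMove M M') : NielsenEquiv M M' :=
  Relation.ReflTransGen.single h

lemma NielsenMove.equiv_symm {M M' : Fin n → G} (h : NielsenMove M M') : NielsenEquiv M' M := by
  cases h with
  | inv i =>
    have := (NielsenMove.inv (Function.update M i (M i)⁻¹) i).equiv
    simpa using this
  | mul i j hij =>
    -- Invert the `j`-th entry, multiply to cancel it from the `i`-th entry, and invert back.
    have h1 := (NielsenMove.inv (Function.update M i (M i * M j)) j).equiv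
    have h2 := (NielsenMove.mul (Function.update (Function.update M i (M i * M j)) j (M j)⁻¹)
      i j hij).equiv
    have h3 := (NielsenMove.inv (Function.update (Function.update M i (M i)) j (M j)⁻¹) j).equiv
    simp only [Function.update_of_ne hij, Function.update_of_ne hij.symm, Function.update_self,
      mul_inv_cancel_right, Function.update_idem, Function.update_comm hij, inv_inv] at h1 h2 h3
    simp only [Function.update_comm hij.symm, Function.update_eq_self] at h1 h2 h3
    exact (h1.trans h2).trans h3
  | swap i j hij =>
    have := (NielsenMove.swap (M ∘ Equiv.swap i j) i j hij).equiv
    have e : (M ∘ Equiv.swap i j) ∘ Equiv.swap i j = M := by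
      funext k; simp
    rwa [e] at this

lemma NielsenEquiv.symm {M M' : Fin n → G} (h : NielsenEquiv M M') : NielsenEquiv M' M := by
  induction h with
  | refl => exact Relation.ReflTransGen.refl
  | tail _ h ih => exact h.equiv_symm.trans ih

lemma nielsenEquiv_update_mul_right (M : Fin n → G) (k : Fin n) {h : G}
    (hh : h ∈ Subgroup.closure (M '' {k}ᶜ)) :
    ∀ g, NielsenEquiv (Function.update M k g) (Function.update M k (g * h)) := by
  induction hh using Subgroup.closure_induction with
  | mem h hh =>
    obtain ⟨j, hj, rfl⟩ := hh
    intro g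
    have hj' : k ≠ j := fun e => hj (by simp [e])
    have := (NielsenMove.mul (Function.update M k g) k j hj').equiv
    simpa [Function.update_of_ne hj'.symm] using this
  | one => intro g; rw [mul_one]; exact Relation.ReflTransGen.refl
  | mul a b _ _ iha ihb => intro g; rw [← mul_assoc]; exact (iha g).trans (ihb _)
  | inv a _ iha =>
    intro g
    have := (iha (g * a⁻¹)).symm
    rwa [inv_mul_cancel_right] at this

lemma nielsenEquiv_update_inv (M : Fin n → G) (k : Fin n) (g : G) :
    NielsenEquiv (Function.update M k g) (Function.update M k g⁻¹) := by
  have := (NielsenMove.inv (Function.update M k g) k).equiv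
  simpa using this

lemma nielsenEquiv_update_mul_left (M : Fin n → G) (k : Fin n) {h : G}
    (hh : h ∈ Subgroup.closure (M '' {k}ᶜ)) (g : G) :
    NielsenEquiv (Function.update M k g) (Function.update M k (h * g)) := by
  have h1 := nielsenEquiv_update_inv M k g
  have h2 := nielsenEquiv_update_mul_right M k (Subgroup.inv_mem _ hh) g⁻¹
  have h3 := nielsenEquiv_update_inv M k (g⁻¹ * h⁻¹)
  rw [mul_inv_rev, inv_inv, inv_inv] at h3
  exact (h1.trans h2).trans h3

/-- The source both of almost minimality in the double coset and of the lower bound on the motion of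
points by `M k * h`. -/
lemma nielsenEquiv_update_double_coset (M : Fin n → G) (k : Fin n) {h h' : G}
    (hh : h ∈ Subgroup.closure (M '' {k}ᶜ)) (hh' : h' ∈ Subgroup.closure (M '' {k}ᶜ)) :
    NielsenEquiv M (Function.update M k (h * M k * h')) := by
  have h1 := nielsenEquiv_update_mul_left M k hh (M k)
  rw [Function.update_eq_self] at h1
  exact h1.trans (nielsenEquiv_update_mul_right M k hh' _)

variable {X : Type v} [MetricSpace X] [MulAction G X]

lemma HasShortFirst.mono {M : Fin n → G} {c c' : ℝ} (h : HasShortFirst X M c) (hc : c ≤ c') :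
    HasShortFirst X M c' := by
  obtain ⟨M', h1, i, h2, h3⟩ := h
  exact ⟨M', h1, i, h2, h3.trans hc⟩

lemma translationLength_le (g : G) (y : X) : translationLength X g ≤ dist y (g • y) :=
  ciInf_le ⟨0, by rintro _ ⟨z, rfl⟩; exact dist_nonneg⟩ y

lemma hasShortFirst_of_entry {M M' : Fin n → G} (h : NielsenEquiv M M') (k : Fin n) {c : ℝ}
    (hk : translationLength X (M' k) ≤ c) : HasShortFirst X M c := by
  have hn : 0 < n := k.pos
  by_cases hk0 : k = ⟨0, hn⟩
  · exact ⟨M', h, k, by simp [hk0], hk⟩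
  · refine ⟨_, h.trans (NielsenMove.swap M' ⟨0, hn⟩ k (Ne.symm hk0)).equiv, ⟨0, hn⟩, rfl, ?_⟩
    simpa using hk

lemma lt_dist_of_not_hasShortFirst {M : Fin n → G} {c : ℝ} (hM : ¬ HasShortFirst X M c)
    (k : Fin n) {h : G} (hh : h ∈ Subgroup.closure (M '' {k}ᶜ)) (y : X) :
    c < dist y (M k • h • y) := by
  by_contra! hlt
  refine hM (hasShortFirst_of_entry (nielsenEquiv_update_double_coset M k (Subgroup.one_mem _) hh)
    k ?_)
  rw [Function.update_self, one_mul]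
  refine (translationLength_le _ y).trans ?_
  rwa [mul_smul]

lemma IsMinimalTuple.disp_le {x : X} {M : Fin n → G} (hM : IsMinimalTuple x M) (k : Fin n)
    {h h' : G} (hh : h ∈ Subgroup.closure (M '' {k}ᶜ)) (hh' : h' ∈ Subgroup.closure (M '' {k}ᶜ)) :
    disp x (M k) ≤ disp x (h * M k * h') + 1 := by
  have h1 := hM _ (nielsenEquiv_update_double_coset M k hh hh')
  unfold tupleDisp at h1
  rw [← Finset.add_sum_erase _ _ (Finset.mem_univ k),
    ← Finset.add_sum_erase (a := k) Finset.univ (fun i => disp x (Function.update M k _ i))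
      (Finset.mem_univ k)] at h1
  have h2 : ∑ i ∈ Finset.univ.erase k, disp x (Function.update M k (h * M k * h') i) =
      ∑ i ∈ Finset.univ.erase k, disp x (M i) := by
    refine Finset.sum_congr rfl fun i hi => ?_
    rw [Function.update_of_ne (Finset.ne_of_mem_erase hi)]
  rw [h2, Function.update_self] at h1
  linarith

end Nielsen

/-! ### Words -/

section Words

variable {G : Type u} [Group G] {n : ℕ}

/-- The letters of the word `w` have their indices in `S`. -/
def LettersIn (S : Finset (Fin n)) (w : List (Fin n × Bool)) : Prop := ∀ a ∈ w, a.1 ∈ S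

@[simp] lemma wordProd_nil (M : Fin n → G) : wordProd M [] = 1 := rfl

lemma wordProd_append (M : Fin n → G) (v w : List (Fin n × Bool)) :
    wordProd M (v ++ w) = wordProd M v * wordProd M w := by
  simp [wordProd]

lemma wordProd_cons (M : Fin n → G) (a : Fin n × Bool) (w : List (Fin n × Bool)) :
    wordProd M (a :: w) = letter M a * wordProd M w := by
  simp [wordProd]

lemma wordProd_singleton (M : Fin n → G) (a : Fin n × Bool) : wordProd M [a] = letter M a := by
  simp [wordProd]

lemma wordProd_eq_lift (M : Fin n → G) (w : List (Fin n × Bool)) :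
    wordProd M w = FreeGroup.lift M (FreeGroup.mk w) := by
  rw [FreeGroup.lift_mk, wordProd]
  congr 2
  funext a
  rcases a with ⟨i, b⟩
  cases b <;> simp [letter]

lemma wordProd_reduce (M : Fin n → G) (w : List (Fin n × Bool)) :
    wordProd M (FreeGroup.reduce w) = wordProd M w := by
  rw [wordProd_eq_lift, wordProd_eq_lift, FreeGroup.reduce.self]

lemma lift_eq_wordProd (M : Fin n → G) (a : FreeGroup (Fin n)) :
    FreeGroup.lift M a = wordProd M a.toWord := by
  rw [wordProd_eq_lift, FreeGroup.mk_toWord]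

lemma isReduced_reduce (w : List (Fin n × Bool)) : FreeGroup.IsReduced (FreeGroup.reduce w) :=
  FreeGroup.isReduced_iff_reduce_eq.2 FreeGroup.reduce.idem

lemma LettersIn.reduce {S : Finset (Fin n)} {w : List (Fin n × Bool)} (h : LettersIn S w) :
    LettersIn S (FreeGroup.reduce w) :=
  fun a ha => h a ((FreeGroup.Red.sublist FreeGroup.reduce.red).subset ha)

lemma letter_mem {M : Fin n → G} {S : Finset (Fin n)} {a : Fin n × Bool} (ha : a.1 ∈ S) :
    letter M a ∈ Subgroup.closure (M '' (S : Set (Fin n))) := by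
  have h : M a.1 ∈ Subgroup.closure (M '' (S : Set (Fin n))) :=
    Subgroup.subset_closure ⟨a.1, ha, rfl⟩
  unfold letter
  split_ifs
  · exact h
  · exact Subgroup.inv_mem _ h

lemma wordProd_mem {M : Fin n → G} {S : Finset (Fin n)} {w : List (Fin n × Bool)}
    (hw : LettersIn S w) : wordProd M w ∈ Subgroup.closure (M '' (S : Set (Fin n))) := by
  refine Subgroup.list_prod_mem _ fun g hg => ?_
  obtain ⟨a, ha, rfl⟩ := List.mem_map.1 hg
  exact letter_mem (hw a ha)

lemma exists_word {M : Fin n → G} {S : Finset (Fin n)} {g : G}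
    (hg : g ∈ Subgroup.closure (M '' (S : Set (Fin n)))) :
    ∃ w, FreeGroup.IsReduced w ∧ LettersIn S w ∧ wordProd M w = g := by
  suffices ∃ w, LettersIn S w ∧ wordProd M w = g by
    obtain ⟨w, hw, rfl⟩ := this
    exact ⟨_, isReduced_reduce w, hw.reduce, wordProd_reduce M w⟩
  induction hg using Subgroup.closure_induction with
  | mem g hg =>
    obtain ⟨i, hi, rfl⟩ := hg
    refine ⟨[(i, true)], fun a ha => ?_, by simp [wordProd, letter]⟩
    rw [List.mem_singleton.1 ha]
    exact hi
  | one => exact ⟨[], fun a ha => by simp at ha, rfl⟩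
  | mul a b _ _ iha ihb =>
    obtain ⟨v, hv, rfl⟩ := iha
    obtain ⟨w, hw, rfl⟩ := ihb
    refine ⟨v ++ w, fun a ha => ?_, wordProd_append M v w⟩
    rcases List.mem_append.1 ha with h | h
    exacts [hv a h, hw a h]
  | inv a _ iha =>
    obtain ⟨v, hv, rfl⟩ := iha
    refine ⟨FreeGroup.invRev v, fun a ha => ?_, ?_⟩
    · simp only [FreeGroup.invRev, List.mem_reverse, List.mem_map] at ha
      obtain ⟨b, hb, rfl⟩ := ha
      exact hv b hb
    · rw [wordProd_eq_lift, wordProd_eq_lift, ← FreeGroup.inv_mk, map_inv]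

/-- The letters of a reduction of a word stand at the same place of the group as in the word. -/
lemma exists_split_of_red {M : Fin n → G} {w w' : List (Fin n × Bool)} (h : FreeGroup.Red w w') :
    ∀ p a q, w' = p ++ a :: q → ∃ p' q', w = p' ++ a :: q' ∧ wordProd M p' = wordProd M p := by
  induction h with
  | refl => intro p a q h; exact ⟨p, q, h, rfl⟩
  | @tail v v' _ hs ih =>
    intro p a q hp
    obtain ⟨p', q', h1, h2⟩ : ∃ p' q', v = p' ++ a :: q' ∧ wordProd M p' = wordProd M p := by
      cases hs with
      | @not L₁ L₂ y b =>
        rcases List.append_eq_append_iff.1 hp with ⟨r, h1, h2⟩ | ⟨r, h1, h2⟩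
        · refine ⟨L₁ ++ (y, b) :: (y, !b) :: r, q, by simp [h2], ?_⟩
          rw [h1, wordProd_append, wordProd_append, wordProd_cons, wordProd_cons]
          cases b <;> simp [letter]
        · cases r with
          | nil =>
            simp only [List.nil_append, List.append_nil] at h1 h2
            refine ⟨L₁ ++ [(y, b), (y, !b)], q, by simp [h2], ?_⟩
            rw [h1, wordProd_append]
            cases b <;> simp [wordProd, letter]
          | cons c r =>
            simp only [List.cons_append, List.cons.injEq] at h2
            obtain ⟨rfl, rfl⟩ := h2
            exact ⟨p, r ++ (y, b) :: (y, !b) :: L₂, by simp [h1], rfl⟩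
    obtain ⟨p'', q'', h3, h4⟩ := ih p' a q' h1
    exact ⟨p'', q'', h3, h4.trans h2⟩

/-- The word `B 0, (k, b 0), …, B (l - 1), (k, b (l - 1))`. -/
def altWord (k : Fin n) (B : ℕ → List (Fin n × Bool)) (b : ℕ → Bool) : ℕ → List (Fin n × Bool)
  | 0 => []
  | i + 1 => altWord k B b i ++ B i ++ [(k, b i)]

/-- The sign of a letter as an exponent. -/
def signUnit (b : Bool) : ℤˣ := if b then 1 else -1

lemma letter_eq_zpow (M : Fin n → G) (k : Fin n) (b : Bool) :
    letter M (k, b) = M k ^ ((signUnit b : ℤˣ) : ℤ) := by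
  cases b <;> simp [letter, signUnit]

lemma wordProd_altWord (M : Fin n → G) (k : Fin n) (B : ℕ → List (Fin n × Bool)) (b : ℕ → Bool)
    (l : ℕ) : wordProd M (altWord k B b l) =
      altPrefix (M k) (fun i => wordProd M (B i)) (fun i => signUnit (b i)) l := by
  induction l with
  | zero => rfl
  | succ l ih =>
    rw [altWord, wordProd_append, wordProd_append, ih, wordProd_singleton, letter_eq_zpow,
      altPrefix]

lemma altWord_congr (k : Fin n) {B B' : ℕ → List (Fin n × Bool)} {b b' : ℕ → Bool} {l : ℕ}
    (hB : ∀ i < l, B i = B' i) (hb : ∀ i < l, b i = b' i) :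
    altWord k B b l = altWord k B' b' l := by
  induction l with
  | zero => rfl
  | succ l ih =>
    rw [altWord, altWord, ih (fun i hi => hB i (by omega)) (fun i hi => hb i (by omega)),
      hB l (by omega), hb l (by omega)]

lemma exists_altWord {S : Finset (Fin n)} (k : Fin n) (w : List (Fin n × Bool))
    (hw : LettersIn S w) : ∃ (l : ℕ) (B : ℕ → List (Fin n × Bool)) (b : ℕ → Bool),
      (∀ i, LettersIn (S.erase k) (B i)) ∧ w = altWord k B b l ++ B l := by
  induction w using List.reverseRecOn with
  | nil => exact ⟨0, fun _ => [], fun _ => true, fun i a ha => by simp at ha, rfl⟩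
  | append_singleton w a ih =>
    obtain ⟨l, B, b, hB, rfl⟩ := ih fun c hc => hw c (by simp [hc])
    by_cases ha : a.1 = k
    · refine ⟨l + 1, Function.update B (l + 1) [], Function.update b l a.2, fun i => ?_, ?_⟩
      · by_cases hi : i = l + 1
        · subst hi
          rw [Function.update_self]
          intro c hc
          simp at hc
        · rw [Function.update_of_ne hi]
          exact hB i
      · have e : altWord k (Function.update B (l + 1) []) (Function.update b l a.2) l =
            altWord k B b l :=
          altWord_congr k (fun i hi => Function.update_of_ne (by omega) _ _)
            (fun i hi => Function.update_of_ne (by omega) _ _)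
        rw [Function.update_self, altWord, e, ← ha]
        simp
    · refine ⟨l, Function.update B l (B l ++ [a]), b, fun i => ?_, ?_⟩
      · by_cases hi : i = l
        · subst hi
          rw [Function.update_self]
          intro c hc
          rcases List.mem_append.1 hc with hc | hc
          · exact hB i c hc
          · rw [List.mem_singleton.1 hc]
            exact Finset.mem_erase.2 ⟨ha, hw a (by simp)⟩
        · rw [Function.update_of_ne hi]
          exact hB i
      · have e : altWord k (Function.update B l (B l ++ [a])) b l = altWord k B b l :=
          altWord_congr k (fun i hi => Function.update_of_ne (by omega) _ _) (fun _ _ => rfl)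
        rw [Function.update_self, e, List.append_assoc]

lemma altWord_prefix (k : Fin n) (B : ℕ → List (Fin n × Bool)) (b : ℕ → Bool) {i l : ℕ}
    (h : i ≤ l) : altWord k B b i <+: altWord k B b l := by
  induction l, h using Nat.le_induction with
  | base => exact List.prefix_rfl
  | succ l _ ih =>
    refine ih.trans ?_
    rw [altWord, List.append_assoc]
    exact List.prefix_append _ _

/-- The word of an alternating product, split at a factor. -/
lemma exists_altWord_split (k : Fin n) (B : ℕ → List (Fin n × Bool)) (b : ℕ → Bool) {i l : ℕ}
    (h : i ≤ l) : ∃ q, altWord k B b l ++ B l = altWord k B b i ++ B i ++ q ∧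
      (i < l → ∃ q', q = (k, b i) :: q') := by
  rcases h.eq_or_lt with rfl | h
  · exact ⟨[], by simp, fun h => absurd h (lt_irrefl _)⟩
  · obtain ⟨q, hq⟩ := altWord_prefix k B b h
    refine ⟨(k, b i) :: (q ++ B l), ?_, fun _ => ⟨_, rfl⟩⟩
    rw [← hq, altWord]
    simp

lemma altWord_length (k : Fin n) (B : ℕ → List (Fin n × Bool)) (b : ℕ → Bool) (l : ℕ) :
    (altWord k B b l ++ B l).length + 1 = ∑ i ∈ Finset.range (l + 1), ((B i).length + 1) := by
  have : ∀ l, (altWord k B b l).length = ∑ i ∈ Finset.range l, ((B i).length + 1) := by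
    intro l
    induction l with
    | zero => simp [altWord]
    | succ l ih =>
      rw [Finset.sum_range_succ, ← ih, altWord]
      simp
  rw [List.length_append, this, Finset.sum_range_succ]
  ring

/-- An empty block between opposite powers of the letter `k` would be a cancelling pair. This
supplies the nontriviality condition on the factors of an alternating product. -/
lemma altWord_isReduced {k : Fin n} {B : ℕ → List (Fin n × Bool)} {b : ℕ → Bool} {l : ℕ}
    (h : FreeGroup.IsReduced (altWord k B b l ++ B l)) :
    (∀ i ≤ l, FreeGroup.IsReduced (B i)) ∧
      ∀ i, i + 1 < l → b i ≠ b (i + 1) → B (i + 1) ≠ [] := by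
  constructor
  · intro i hi
    obtain ⟨q, hq, -⟩ := exists_altWord_split k B b hi
    exact h.infix ⟨altWord k B b i, q, hq.symm⟩
  · intro i hi hb hnil
    obtain ⟨q, hq, hq'⟩ := exists_altWord_split k B b hi.le
    obtain ⟨q', rfl⟩ := hq' hi
    have h2 : FreeGroup.IsReduced [(k, b i), (k, b (i + 1))] := by
      refine h.infix ⟨altWord k B b i ++ B i, q', ?_⟩
      rw [hq, hnil, altWord]
      simp
    rw [FreeGroup.isReduced_cons_cons] at h2
    exact hb (h2.1 rfl)

end Words

/-! ### Subgroups generated by part of a minimal tuple -/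

section Subtuples

variable {G : Type u} {X : Type v} [Group G] [MetricSpace X] [MulAction G X] {n : ℕ}

/-- The subgroup generated by the entries of `M` with index in `S`. -/
abbrev spanOf (M : Fin n → G) (S : Finset (Fin n)) : Subgroup G :=
  Subgroup.closure (M '' (S : Set (Fin n)))

/-- The entries of `M` with index in `S` freely generate a subgroup that is quasi-isometrically
embedded by its orbit map, and the words in these entries track geodesics. -/
structure SubtupleGeometry (x : X) (M : Fin n → G) (S : Finset (Fin n)) (d₂ d₃ : ℝ) : Prop where
  ne_one : ∀ w, FreeGroup.IsReduced w → LettersIn S w → w ≠ [] → wordProd M w ≠ 1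
  qi : ∃ lam ε : ℝ, 0 ≤ lam ∧ 0 ≤ ε ∧ ∀ w, FreeGroup.IsReduced w → LettersIn S w →
    (w.length : ℝ) ≤ lam * disp x (wordProd M w) + ε
  fellow : ∀ w, FreeGroup.IsReduced w → LettersIn S w → w ≠ [] →
    ∀ z, AlmostOn x 1 (wordProd M w) 24 z →
      ∃ p a q, w = p ++ a :: q ∧ AlmostOn x (wordProd M p) (letter M a) d₂ z
  length : ∀ w, FreeGroup.IsReduced w → LettersIn S w → ∀ a ∈ w,
    disp x (M a.1) - d₃ ≤ disp x (wordProd M w)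

/-- Every part of length greater than `d` of a geodesic `[x, u x]`, where `u` lies in the subgroup
generated by the entries with index in `S`, comes `(|g_i|_x / 2 - c)`-close to the orbit of this
subgroup for some `i ∈ S`. -/
def SubtupleMeets (x : X) (M : Fin n → G) (S : Finset (Fin n)) (c d : ℝ) : Prop :=
  ∀ u ∈ spanOf M S, ∀ γ : ℝ → X, IsGeodesicFromTo γ x (u • x) →
    ∀ a b : ℝ, 0 ≤ a → b ≤ dist x (u • x) → d < b - a →
      ∃ t ∈ Icc a b, ∃ v ∈ spanOf M S, ∃ i ∈ S, dist (γ t) (v • x) ≤ disp x (M i) / 2 - c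

lemma spanOf_mono (M : Fin n → G) {S S' : Finset (Fin n)} (h : S ⊆ S') :
    spanOf M S ≤ spanOf M S' :=
  Subgroup.closure_mono (image_mono (by exact_mod_cast h))

lemma SubtupleMeets.mono {x : X} {M : Fin n → G} {S : Finset (Fin n)} {c c' d d' : ℝ}
    (h : SubtupleMeets x M S c d) (hc : c' ≤ c) (hd : d ≤ d') : SubtupleMeets x M S c' d' := by
  intro u hu γ hγ a b ha hb hab
  obtain ⟨t, ht, v, hv, i, hi, k⟩ := h u hu γ hγ a b ha hb (by linarith)
  exact ⟨t, ht, v, hv, i, hi, by linarith⟩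

lemma SubtupleGeometry.mono {x : X} {M : Fin n → G} {S : Finset (Fin n)} {d₂ d₃ d₂' d₃' : ℝ}
    (h : SubtupleGeometry x M S d₂ d₃) (h₂ : d₂ ≤ d₂') (h₃ : d₃ ≤ d₃') :
    SubtupleGeometry x M S d₂' d₃' where
  ne_one := h.ne_one
  qi := h.qi
  fellow w hw hS hne z hz := by
    obtain ⟨p, a, q, h1, h2⟩ := h.fellow w hw hS hne z hz
    exact ⟨p, a, q, h1, h2.mono h₂⟩
  length w hw hS a ha := by linarith [h.length w hw hS a ha]

/-- The powers of a nontrivial element move the base-point arbitrarily far. -/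
lemma SubtupleGeometry.exists_pow {x : X} {M : Fin n → G} {S : Finset (Fin n)} {d₂ d₃ : ℝ}
    (hS : SubtupleGeometry x M S d₂ d₃) {h : G} (hh : h ∈ spanOf M S) (h1 : h ≠ 1) (B : ℝ) :
    ∃ m : ℕ, B < disp x (h ^ m) := by
  by_contra! hB
  obtain ⟨w, -, hw, rfl⟩ := exists_word hh
  obtain ⟨lam, ε, hlam, hε, hqi⟩ := hS.qi
  set f : FreeGroup (Fin n) := FreeGroup.mk w with hf
  have hlift : ∀ m : ℕ, wordProd M (f ^ m).toWord = wordProd M w ^ m := by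
    intro m
    rw [← lift_eq_wordProd, map_pow, hf, ← wordProd_eq_lift]
  have hf1 : f ≠ 1 := by
    intro h0
    apply h1
    rw [wordProd_eq_lift, ← hf, h0, map_one]
  have hlet : ∀ m : ℕ, LettersIn S (f ^ m).toWord := by
    intro m
    rw [FreeGroup.toWord_pow]
    refine LettersIn.reduce fun a ha => ?_
    simp only [List.mem_flatten, List.mem_replicate] at ha
    obtain ⟨_, ⟨-, rfl⟩, ha⟩ := ha
    rw [hf, FreeGroup.toWord_mk] at ha
    exact hw.reduce a ha
  obtain ⟨N, hN⟩ := exists_nat_ge (lam * B + ε)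
  have hlen : ∀ m : ℕ, (f ^ m).toWord.length ≤ N := by
    intro m
    have k1 := hqi _ FreeGroup.isReduced_toWord (hlet m)
    rw [hlift] at k1
    have k2 := mul_le_mul_of_nonneg_left (hB m) hlam
    exact_mod_cast (show ((f ^ m).toWord.length : ℝ) ≤ N by linarith)
  -- Free groups are torsion-free, so the powers give infinitely many reduced words, whereas bounded
  -- displacement bounds their length.
  have hinj : Function.Injective fun m : ℕ => (f ^ m).toWord :=
    FreeGroup.toWord_injective.comp
      (injective_pow_iff_not_isOfFinOrder.2 (by rwa [isOfFinOrder_iff_eq_one]))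
  exact Set.infinite_range_of_injective hinj
    ((List.finite_length_le (Fin n × Bool) N).subset (by rintro _ ⟨m, rfl⟩; exact hlen m))

variable [IsIsometricSMul G X]

/-- A point in the middle of a long geodesic `[x, h ^ m x]` is moved by `h` not much more than a
given point. -/
lemma dist_smul_le_of_mem_geodesic (hF : FourPoint X) {x y : X} {h : G} {m : ℕ} {γ : ℝ → X}
    (hγ : IsGeodesicFromTo γ x (h ^ m • x)) {t : ℝ} (ht : dist x y + 5 ≤ t)
    (ht' : t ≤ dist x (h ^ m • x) - (dist x y + 5)) :
    dist (γ t) (h • γ t) ≤ dist y (h • y) + 16 := by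
  have hD := dist_nonneg (x := x) (y := y)
  have htm : t ∈ Icc (0 : ℝ) (dist x (h ^ m • x)) := ⟨by linarith, by linarith⟩
  have g1 := hγ.dist_left htm
  have g2 := hγ.dist_right htm
  have e1 : dist (h ^ m • x) (h ^ m • y) = dist x y := dist_smul _ _ _
  have k1 := hF.dist_le (p := x) (q := h ^ m • x) (z := γ t) (ε := 0) (by linarith) y
  have k2 := hF.dist_le (p := x) (q := h ^ m • x) (z := γ t) (ε := 0) (by linarith) (h ^ m • y)
  have k3 := hF y x (h ^ m • x) (h ^ m • y)
  have n1 := dist_nonneg (x := γ t) (y := y)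
  have n2 := dist_nonneg (x := γ t) (y := h ^ m • y)
  have n3 := dist_nonneg (x := y) (y := h ^ m • y)
  rw [dist_comm (h ^ m • x) y] at k1
  rw [dist_comm y x] at k3
  have hon : dist y (γ t) + dist (γ t) (h ^ m • y) ≤ dist y (h ^ m • y) + 12 := by
    rw [dist_comm y (γ t)]
    rcases k1 with k1 | k1
    · linarith
    rcases k2 with k2 | k2
    · rcases k3 with k3 | k3 <;> linarith
    · linarith
  -- `γ t` lies on `[y, h ^ m y]` up to `12`. Since `h` shifts both endpoints by `dist y (h • y)`,
  -- one further four-point inequality gives `12 + 4 = 16`.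
  have k4 := hF y (γ t) (h ^ m • y) (h • γ t)
  have e2 : dist (h ^ m • y) (h • h ^ m • y) = dist y (h • y) := by
    rw [smul_smul, ← pow_succ', pow_succ, mul_smul, dist_smul]
  have t1 := dist_triangle (h ^ m • y) (h • h ^ m • y) (h • γ t)
  have t2 := dist_triangle y (h • y) (h • γ t)
  rw [dist_smul h] at t1 t2
  rw [dist_comm (h ^ m • y) (γ t)] at t1
  rcases k4 with k4 | k4 <;> linarith

/-- The nontrivial elements of a subgroup generated by a part of the tuple move all points far. -/
lemma lt_dist_of_mem_spanOf (hX : IsHyperbolicSpace 1 X) {x : X} {M : Fin n → G} {s : ℕ}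
    {d₂ d₃ c d₄ R : ℝ} (hgeo : ∀ S : Finset (Fin n), S.card ≤ s → SubtupleGeometry x M S d₂ d₃)
    (hmeets : ∀ S : Finset (Fin n), S.card ≤ s → SubtupleMeets x M S c d₄)
    (hc : R + 16 + d₃ < 2 * c) (S : Finset (Fin n)) :
    S.card ≤ s → ∀ h ∈ spanOf M S, h ≠ 1 → ∀ y : X, R < dist y (h • y) := by
  induction S using Finset.strongInduction with
  | H S ih =>
    intro hs h hh h1 y
    by_contra! hy
    obtain ⟨m, hm⟩ := (hgeo S hs).exists_pow hh h1 (2 * dist x y + 10 + d₄)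
    obtain ⟨γ, hγ⟩ := hX.1 x (h ^ m • x)
    have hD := dist_nonneg (x := x) (y := y)
    unfold disp at hm
    obtain ⟨t, ht, v, hv, i, hi, hvt⟩ := hmeets S hs _ (Subgroup.pow_mem _ hh m) γ hγ
      (dist x y + 5) (dist x (h ^ m • x) - (dist x y + 5)) (by linarith) (by linarith)
      (by linarith)
    have hz := dist_smul_le_of_mem_geodesic hX.fourPoint hγ ht.1 ht.2
    have hk : v⁻¹ * h * v ∈ spanOf M S :=
      Subgroup.mul_mem _ (Subgroup.mul_mem _ (Subgroup.inv_mem _ hv) hh) hv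
    have hk1 : v⁻¹ * h * v ≠ 1 := by
      intro h0
      apply h1
      have : h = v * (v⁻¹ * h * v) * v⁻¹ := by group
      rw [this, h0]
      group
    have hconj : ∀ z : X, dist (v⁻¹ • z) ((v⁻¹ * h * v) • v⁻¹ • z) = dist z (h • z) := by
      intro z
      rw [mul_smul, mul_smul, smul_inv_smul, dist_smul]
    have hdisp : disp x (v⁻¹ * h * v) ≤ disp x (M i) - 2 * c + R + 16 := by
      have e := hconj (v • x)
      rw [inv_smul_smul] at e
      have t1 := dist_triangle4 (v • x) (γ t) (h • γ t) (h • v • x)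
      rw [dist_smul, dist_comm (v • x) (γ t)] at t1
      unfold disp at *
      linarith
    obtain ⟨w, hw, hwS, hwk⟩ := exists_word hk
    -- By `hc` the conjugate is shorter than `|g_i| - d₃`, so the length bound keeps `g_i` out of
    -- its word. The conjugate then lies in a smaller subgroup and moves `v⁻¹ y` exactly as `h`
    -- moves `y`.
    by_cases hiw : ∃ a ∈ w, a.1 = i
    · obtain ⟨a, ha, rfl⟩ := hiw
      have := (hgeo S hs).length w hw hwS a ha
      rw [hwk] at this
      linarith
    · push Not at hiw
      have hwS' : LettersIn (S.erase i) w :=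
        fun a ha => Finset.mem_erase.2 ⟨hiw a ha, hwS a ha⟩
      have := ih (S.erase i) (Finset.erase_ssubset hi) ((Finset.card_erase_le).trans hs)
        (v⁻¹ * h * v) (hwk ▸ wordProd_mem hwS') hk1 (v⁻¹ • y)
      rw [hconj] at this
      linarith

/-- The last entry of a minimal tuple gives an edge over the subgroup generated by others. -/
lemma exists_isEdge (hX : IsHyperbolicSpace 1 X) {x : X} {M : Fin n → G}
    (hM : IsMinimalTuple x M) {S : Finset (Fin n)} {k : Fin n} (hk : k ∉ S)
    (hmax : ∀ i ∈ S, disp x (M i) ≤ disp x (M k)) {d d' c₁ R : ℝ} (hd : 0 ≤ d) (hd' : 0 ≤ d')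
    (hm : SubtupleMeets x M S (1 + 68) d) (hm' : SubtupleMeets x M S (d + 53 + 68) d')
    (hmoves : ∀ h ∈ spanOf M S, h ≠ 1 → ∀ y : X, R < dist y (h • y))
    (hshort : ¬ HasShortFirst X M c₁) (hR : 2 * R + 2 ≤ c₁) (hR0 : 0 ≤ R) :
    ∃ m, IsEdge x (spanOf M S) (M k) m (3 * d + d' + 300) R := by
  have hle : spanOf M S ≤ Subgroup.closure (M '' {k}ᶜ) :=
    Subgroup.closure_mono (image_mono fun i hi => by
      simp only [mem_compl_iff, mem_singleton_iff]
      rintro rfl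
      exact hk hi)
  have hdense : ∀ c d, SubtupleMeets x M S c d →
      OrbitDense x (spanOf M S) (disp x (M k) / 2 - c) d := by
    intro c d h u hu γ hγ a b ha hb hab
    obtain ⟨t, ht, v, hv, i, hi, hle⟩ := h u hu γ hγ a b ha hb hab
    exact ⟨t, ht, v, hv, by linarith [hmax i hi]⟩
  have hmin : ∀ h ∈ spanOf M S, ∀ h' ∈ spanOf M S,
      disp x (M k) - 1 ≤ dist (h • x) (M k • h' • x) := by
    intro h hh h' hh'
    have := hM.disp_le k (hle (Subgroup.inv_mem _ hh)) (hle hh')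
    rw [← dist_smul h⁻¹, inv_smul_smul, smul_smul, smul_smul]
    unfold disp at *
    linarith
  have hmv : ∀ h ∈ spanOf M S, ∀ y : X, c₁ < dist y (M k • h • y) := fun h hh y =>
    lt_dist_of_not_hasShortFirst hshort k (hle hh) y
  obtain ⟨γ, hγ⟩ := hX.1 x (M k • x)
  have ht : disp x (M k) / 2 ∈ Icc (0 : ℝ) (dist x (M k • x)) := by
    have : (0 : ℝ) ≤ dist x (M k • x) := dist_nonneg
    unfold disp
    constructor <;> linarith
  have h1 := hγ.dist_left ht
  have h2 := hγ.dist_right ht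
  have h2' : dist (γ (disp x (M k) / 2)) (M k • x) = disp x (M k) / 2 := by
    rw [h2]; unfold disp; ring
  refine ⟨γ (disp x (M k) / 2), h1, h2', hmin, fun e f he hf => ?_, fun h hh hne y =>
    (hmoves h hh hne y).le, fun h hh y => by linarith [hmv h hh y], ?_⟩
  · exact OrbitDense.gromov_bounded hX hd hd' (hdense _ _ hm) (hdense _ _ hm') hmin he hf
      ⟨1, Subgroup.one_mem _, by rw [one_smul, dist_comm, h1]⟩
      ⟨1, Subgroup.one_mem _, by rw [one_smul, h2']⟩
  · have := hmv 1 (Subgroup.one_mem _) x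
    rw [one_smul] at this
    unfold disp
    linarith

end Subtuples

/-! ### Adding a longest entry to a subtuple -/

section Step

variable {G : Type u} {X : Type v} [Group G] [MetricSpace X] [MulAction G X] {n : ℕ}

lemma signUnit_eq_neg {b b' : Bool} (h : signUnit b = -signUnit b') : b ≠ b' := by
  rintro rfl
  revert h
  cases b <;> decide

/-- A reduced word in the letters `S` is an alternating product of reduced words in the letters
`S \ {k}` and the letters `k^{±1}`. -/
lemma exists_alternating {x : X} {M : Fin n → G} {S : Finset (Fin n)} {k : Fin n} {d₂ d₃ : ℝ}
    (hS : SubtupleGeometry x M (S.erase k) d₂ d₃) {w : List (Fin n × Bool)}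
    (hw : FreeGroup.IsReduced w) (hwS : LettersIn S w) :
    ∃ (l : ℕ) (B : ℕ → List (Fin n × Bool)) (b : ℕ → Bool), w = altWord k B b l ++ B l ∧
      (∀ i, LettersIn (S.erase k) (B i)) ∧ (∀ i ≤ l, FreeGroup.IsReduced (B i)) ∧
      (∀ i, i + 1 < l → signUnit (b i) = -signUnit (b (i + 1)) → wordProd M (B (i + 1)) ≠ 1) ∧
      wordProd M w = altPrefix (M k) (fun i => wordProd M (B i)) (fun i => signUnit (b i)) l *
        wordProd M (B l) := by
  obtain ⟨l, B, b, hB, rfl⟩ := exists_altWord k w hwS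
  obtain ⟨h1, h2⟩ := altWord_isReduced hw
  refine ⟨l, B, b, rfl, hB, h1, fun i hi hs => ?_, ?_⟩
  · exact hS.ne_one _ (h1 _ hi.le) (hB _) (h2 i hi (signUnit_eq_neg hs))
  · rw [wordProd_append, wordProd_altWord]

lemma altPrefix_mem {K : Subgroup G} {g : G} (hg : g ∈ K) {h : ℕ → G} (hh : ∀ i, h i ∈ K)
    (ε : ℕ → ℤˣ) (i : ℕ) : altPrefix g h ε i ∈ K := by
  induction i with
  | zero => exact K.one_mem
  | succ i ih => exact K.mul_mem (K.mul_mem ih (hh i)) (K.zpow_mem hg _)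

variable [IsIsometricSMul G X] {x m : X} {M : Fin n → G} {S : Finset (Fin n)} {k : Fin n}
  {d₂ d₃ ω R : ℝ}

namespace IsEdge

lemma dist_altPoint_ge (E : IsEdge x (spanOf M (S.erase k)) (M k) m ω R) {h : ℕ → G}
    {ε : ℕ → ℤˣ} {l i : ℕ} (hi : i ≤ l) :
    disp x (h i) ≤ dist (altPoint x (M k) m h ε l i) (altPoint x (M k) m h ε l (i + 1)) +
      disp x (M k) := by
  have h1 := E.dist_altPoint_le (h := h) (ε := ε) hi
  have h2 := E.dist_altPoint_le' (h := h) (ε := ε) hi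
  rw [← dist_smul_smul_mul x (altPrefix (M k) h ε i) (h i)]
  have t := dist_triangle4 (altPrefix (M k) h ε i • x) (altPoint x (M k) m h ε l i)
    (altPoint x (M k) m h ε l (i + 1)) ((altPrefix (M k) h ε i * h i) • x)
  rw [dist_comm (altPrefix (M k) h ε i • x) (altPoint x (M k) m h ε l i)] at t
  linarith

/-- Each of the two end sides is at least `|g_k|/2 - 1` long, and both survive in the distance of
the endpoints up to `2 * ω + 4`. -/
lemma le_disp_alternating (hF : FourPoint X)
    (E : IsEdge x (spanOf M (S.erase k)) (M k) m ω R) (hω : 0 ≤ ω) (hR : 2 * ω + 6 < R)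
    {h : ℕ → G} {ε : ℕ → ℤˣ} {l : ℕ} (hl : 0 < l) (hH : ∀ i ≤ l, h i ∈ spanOf M (S.erase k))
    (hne : ∀ i, i + 1 < l → ε i = -ε (i + 1) → h (i + 1) ≠ 1) :
    disp x (M k) - (2 * ω + 6) ≤ disp x (altPrefix (M k) h ε l * h l) := by
  have hB := E.isBrokenPath hl hH hne
  have h1 := hB.ends_le_dist hF hω hR (by omega)
  have h2 := E.le_dist_altPoint_first (ε := ε) hl (hH 0 hl.le)
  have h3 := E.le_dist_altPoint_last (ε := ε) hl (hH l le_rfl)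
  rw [Nat.add_sub_cancel, altPoint_last] at h1
  rw [altPoint_last] at h3
  change _ ≤ dist x _ + _ + _ at h1
  unfold disp at *
  linarith

/-- Every point almost on `[x, w x]` lies almost on the segment of a letter of `w`. -/
lemma fellow_alternating (hX : IsHyperbolicSpace 1 X)
    (hS : SubtupleGeometry x M (S.erase k) d₂ d₃) (hd₂ : 0 ≤ d₂)
    (E : IsEdge x (spanOf M (S.erase k)) (M k) m ω R) (hω : 0 ≤ ω) (hR : 8 * ω + 100 < R)
    {l : ℕ} (hl : 0 < l) {B : ℕ → List (Fin n × Bool)} {b : ℕ → Bool}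
    (hB : ∀ i, LettersIn (S.erase k) (B i)) (hred : ∀ i ≤ l, FreeGroup.IsReduced (B i))
    (hne : ∀ i, i + 1 < l → signUnit (b i) = -signUnit (b (i + 1)) →
      wordProd M (B (i + 1)) ≠ 1) {z : X}
    (hz : AlmostOn x 1 (wordProd M (altWord k B b l ++ B l)) 24 z) :
    ∃ p a q, altWord k B b l ++ B l = p ++ a :: q ∧
      AlmostOn x (wordProd M p) (letter M a) (d₂ + 80) z := by
  have hF := hX.fourPoint
  set h : ℕ → G := fun i => wordProd M (B i) with hh
  set ε : ℕ → ℤˣ := fun i => signUnit (b i) with hε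
  have hw : wordProd M (altWord k B b l ++ B l) = altPrefix (M k) h ε l * h l := by
    rw [wordProd_append, wordProd_altWord]
  rw [hw] at hz
  obtain ⟨γ, hγ⟩ := hX.1 x ((altPrefix (M k) h ε l * h l) • x)
  obtain ⟨t, ht, hzt⟩ := hF.exists_near hγ (z := z) (ε := 24)
    (by simpa [AlmostOn, disp] using hz)
  obtain ⟨c, hc, hcov⟩ := E.exists_pieces (h := h) (ε := ε) hF hl (fun i _ => wordProd_mem (hB i)) hne hω
    (Λ := 0) le_rfl (by linarith) hγ ht.1 ht.2 (by simp)
  obtain ⟨j, hj⟩ := hcov t ⟨le_rfl, le_rfl⟩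
  have hcj := hc j
  -- the segments of the letters `g_k^{±1}`
  have hbig : ∀ i < l, AlmostOn x (pieceStart (M k) h ε (true, i)) (pieceElt (M k) h ε (true, i))
      24 (γ t) → ∃ p a q, altWord k B b l ++ B l = p ++ a :: q ∧
        AlmostOn x (wordProd M p) (letter M a) (d₂ + 80) z := by
    intro i hi hon
    obtain ⟨q, hq, hq'⟩ := exists_altWord_split k B b hi.le
    obtain ⟨q', rfl⟩ := hq' hi
    refine ⟨altWord k B b i ++ B i, (k, b i), q', hq, ?_⟩
    rw [wordProd_append, wordProd_altWord, letter_eq_zpow]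
    exact (hon.of_dist_le hzt).mono (by linarith)
  rcases hci : c j with ⟨b', i⟩
  rw [hci] at hj hcj
  cases b'
  · have hi : i ≤ l := by simpa [IsPieceIndex] using hcj
    change AlmostOn x (altPrefix (M k) h ε i) (h i) 24 (γ t) at hj
    -- An empty block contributes no letter; its segment is a point, which is an endpoint of a
    -- neighboring edge, and such an edge exists because `0 < l`.
    by_cases hBi : B i = []
    · have hh1 : h i = 1 := by rw [hh]; simp [hBi]
      rw [hh1] at hj
      simp only [AlmostOn, mul_one, disp, one_smul, dist_self] at hj
      rcases hi.eq_or_lt with rfl | hi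
      · obtain ⟨i, rfl⟩ := Nat.exists_eq_succ_of_ne_zero hl.ne'
        refine hbig i (Nat.lt_succ_self i) ?_
        simp only [pieceStart, pieceElt, if_true, AlmostOn]
        rw [← dist_smul_smul_mul x (altPrefix (M k) h ε i * h i)]
        have e : altPrefix (M k) h ε i * h i * M k ^ ((ε i : ℤˣ) : ℤ) =
          altPrefix (M k) h ε (i + 1) := rfl
        rw [e]
        rw [Nat.succ_eq_add_one] at hj
        have t := dist_triangle ((altPrefix (M k) h ε i * h i) • x)
          (altPrefix (M k) h ε (i + 1) • x) (γ t)
        linarith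
      · refine hbig i hi ?_
        simp only [pieceStart, pieceElt, if_true, AlmostOn, hh1, mul_one]
        have t := dist_triangle (γ t) (altPrefix (M k) h ε i • x)
          ((altPrefix (M k) h ε i * M k ^ ((ε i : ℤˣ) : ℤ)) • x)
        rw [dist_smul_smul_mul] at t
        linarith
    · have hon := hj.smul (altPrefix (M k) h ε i)⁻¹
      rw [inv_mul_cancel] at hon
      obtain ⟨p, a, q, hpq, hp⟩ := hS.fellow (B i) (hred i hi) (hB i) hBi _ hon
      obtain ⟨q', hq', -⟩ := exists_altWord_split k B b hi
      refine ⟨altWord k B b i ++ p, a, q ++ q', by rw [hq', hpq]; simp, ?_⟩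
      have := hp.smul (altPrefix (M k) h ε i)
      rw [smul_inv_smul] at this
      rw [wordProd_append, wordProd_altWord]
      exact (this.of_dist_le hzt).mono (by linarith)
  · exact hbig i (by simpa [IsPieceIndex] using hcj) hj

/-- Adding the index of the edge to the subtuple preserves its geometric properties. -/
lemma subtupleGeometry (hX : IsHyperbolicSpace 1 X)
    (hS : SubtupleGeometry x M (S.erase k) d₂ d₃) (hd₂ : 0 ≤ d₂)
    (hmax : ∀ i ∈ S, disp x (M i) ≤ disp x (M k))
    (E : IsEdge x (spanOf M (S.erase k)) (M k) m ω R) (hω : 0 ≤ ω) (hR : 8 * ω + 100 < R) :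
    SubtupleGeometry x M S (d₂ + 80) (max d₃ (2 * ω + 6)) := by
  have hF := hX.fourPoint
  have hlow := fun (h : ℕ → G) (ε : ℕ → ℤˣ) (l : ℕ) (hl : 0 < l) =>
    E.le_disp_alternating hF hω (by linarith) (h := h) (ε := ε) hl
  have hlong := E.long
  refine ⟨fun w hw hwS hne => ?_, ?_, fun w hw hwS hne z hz => ?_, fun w hw hwS a ha => ?_⟩
  · obtain ⟨l, B, b, rfl, hB, hred, hn1, hprod⟩ := exists_alternating hS hw hwS
    rcases Nat.eq_zero_or_pos l with rfl | hl
    · rw [altWord, List.nil_append] at *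
      exact hS.ne_one _ (hred 0 le_rfl) (hB 0) hne
    · intro h1
      have := hlow _ _ l hl (fun i _ => wordProd_mem (hB i)) hn1
      rw [← hprod, h1] at this
      simp only [disp, one_smul, dist_self] at *
      linarith
  · obtain ⟨lam, η, hlam, hη, hqi⟩ := hS.qi
    -- Passing from `disp x (h i)` to the side of the broken path costs `disp x (M k)`. Every side
    -- exceeds `2 * ω + 5`, so all additive constants of a block are absorbed into the
    -- multiplicative one before summation.
    have hℓ : 0 ≤ disp x (M k) := dist_nonneg
    refine ⟨lam + (lam * (2 * ω + 4 + disp x (M k)) + η + 1), η, by positivity, hη,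
      fun w hw hwS => ?_⟩
    obtain ⟨l, B, b, rfl, hB, hred, hn1, hprod⟩ := exists_alternating hS hw hwS
    rw [hprod]
    rcases Nat.eq_zero_or_pos l with rfl | hl
    · have := hqi _ (hred 0 le_rfl) (hB 0)
      simp only [altWord, List.nil_append, altPrefix, one_mul]
      have h1 : 0 ≤ disp x (wordProd M (B 0)) := dist_nonneg
      have h2 : 0 ≤ (lam * (2 * ω + 4 + disp x (M k)) + η + 1) * disp x (wordProd M (B 0)) := by
        positivity
      linarith
    · set h : ℕ → G := fun i => wordProd M (B i) with hh
      set ε : ℕ → ℤˣ := fun i => signUnit (b i) with hε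
      have hBr := E.isBrokenPath hl (fun i _ => wordProd_mem (hB i)) hn1
      have hsum := hBr.sum_le_dist hF hω (by linarith)
      rw [altPoint_last] at hsum
      change _ ≤ disp x (altPrefix (M k) h ε l * h l) at hsum
      have hlen : ((altWord k B b l ++ B l).length : ℝ) + 1 =
          ∑ i ∈ Finset.range (l + 1), (((B i).length : ℝ) + 1) := by
        exact_mod_cast altWord_length k B b l
      have hterm : ∀ i ∈ Finset.range (l + 1), ((B i).length : ℝ) + 1 ≤
          (lam + (lam * (2 * ω + 4 + disp x (M k)) + η + 1)) *
            (dist (altPoint x (M k) m h ε l i) (altPoint x (M k) m h ε l (i + 1)) -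
              (2 * ω + 4)) := by
        intro i hi
        have hi : i ≤ l := Nat.lt_succ_iff.1 (Finset.mem_range.1 hi)
        have h1 := hqi _ (hred i hi) (hB i)
        have h2 := E.dist_altPoint_ge (h := h) (ε := ε) hi
        have h3 := hBr.long i (by omega)
        set D := dist (altPoint x (M k) m h ε l i) (altPoint x (M k) m h ε l (i + 1)) with hD
        have h4 : lam * disp x (h i) ≤ lam * (D + disp x (M k)) :=
          mul_le_mul_of_nonneg_left h2 hlam
        have h5 : 1 ≤ D - (2 * ω + 4) := by linarith
        have h6 : (lam * (2 * ω + 4 + disp x (M k)) + η + 1) * 1 ≤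
            (lam * (2 * ω + 4 + disp x (M k)) + η + 1) * (D - (2 * ω + 4)) :=
          mul_le_mul_of_nonneg_left h5 (by positivity)
        linarith
      have := Finset.sum_le_sum hterm
      rw [← Finset.mul_sum, ← hlen] at this
      have h7 := mul_le_mul_of_nonneg_left hsum
        (show 0 ≤ lam + (lam * (2 * ω + 4 + disp x (M k)) + η + 1) by positivity)
      linarith
  · obtain ⟨l, B, b, rfl, hB, hred, hn1, -⟩ := exists_alternating hS hw hwS
    rcases Nat.eq_zero_or_pos l with rfl | hl
    · simp only [altWord, List.nil_append] at *
      obtain ⟨p, a, q, h1, h2⟩ := hS.fellow _ (hred 0 le_rfl) (hB 0) hne z hz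
      exact ⟨p, a, q, h1, h2.mono (by linarith)⟩
    · exact E.fellow_alternating hX hS hd₂ hω hR hl hB hred hn1 hz
  · obtain ⟨l, B, b, rfl, hB, hred, hn1, hprod⟩ := exists_alternating hS hw hwS
    rcases Nat.eq_zero_or_pos l with rfl | hl
    · simp only [altWord, List.nil_append] at *
      have := hS.length _ (hred 0 le_rfl) (hB 0) a ha
      linarith [le_max_left d₃ (2 * ω + 6)]
    · have := hlow _ _ l hl (fun i _ => wordProd_mem (hB i)) hn1
      rw [← hprod] at this
      linarith [hmax a.1 (hwS a ha), le_max_right d₃ (2 * ω + 6)]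

end IsEdge

/-- If alternating products track geodesics at a large scale, then geodesics between orbit points
often come close to the orbit. -/
lemma subtupleMeets_of_track (hX : IsHyperbolicSpace 1 X) (hk : k ∈ S)
    (hS : SubtupleGeometry x M (S.erase k) d₂ d₃) {c d T : ℝ}
    (hm : SubtupleMeets x M (S.erase k) (c + 16) d) (hd : 0 ≤ d) (hT : d < T) (hT' : 2 * c + 32 ≤ T)
    (htrack : AlternatingProductsTrack x (spanOf M (S.erase k)) (M k) 16 T) :
    SubtupleMeets x M S c (10 * T) := by
  intro u hu γ hγ a b ha hb hab
  obtain ⟨w, hw, hwS, rfl⟩ := exists_word hu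
  obtain ⟨l, B, e, -, hB, -, hn1, hprod⟩ := exists_alternating hS hw hwS
  have hkS : M k ∈ spanOf M S := Subgroup.subset_closure ⟨k, hk, rfl⟩
  have hBS : ∀ i, wordProd M (B i) ∈ spanOf M S := fun i =>
    spanOf_mono M (Finset.erase_subset k S) (wordProd_mem (hB i))
  have hpre := fun i => altPrefix_mem hkS hBS (fun i => signUnit (e i)) i
  rw [hprod] at hγ hb
  rcases htrack l (fun i => wordProd M (B i)) (fun i => signUnit (e i))
    (fun i _ => wordProd_mem (hB i)) hn1 γ hγ a b ha hb hab.le with ⟨i, -, hN⟩ | ⟨i, -, hN⟩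
  · set p := altPrefix (M k) (fun i => wordProd M (B i)) (fun i => signUnit (e i)) i *
      wordProd M (B i) with hp
    have hpS : p ∈ spanOf M S := Subgroup.mul_mem _ (hpre i) (hBS i)
    set g := M k ^ ((signUnit (e i) : ℤˣ) : ℤ) with hg
    have hgS : g ∈ spanOf M S := Subgroup.zpow_mem _ hkS _
    have hgd : dist x (g • x) = disp x (M k) := disp_zpow_units x (M k) _
    obtain ⟨β, hβ⟩ := hX.1 x (g • x)
    obtain ⟨s, t, hs, ht, hst, hq⟩ := hN β hβ
    -- A piece of length `T` of the edge has an end at distance at most `(|g_k| - T)/2` from an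
    -- endpoint of the edge; with the error `16` this is where `2 * c + 32 ≤ T` enters.
    rcases le_total s (dist x (g • x) - t) with hle | hle
    · obtain ⟨y, hy, hqy⟩ := hq s ⟨le_rfl, by linarith⟩
      refine ⟨y, hy, p, hpS, k, hk, ?_⟩
      have h1 := hβ.dist_left (t := s) ⟨hs, by linarith⟩
      have h2 := dist_triangle (γ y) (p • β s) (p • x)
      rw [dist_smul, dist_comm (β s), h1, dist_comm (γ y) (p • β s)] at h2
      linarith
    · obtain ⟨y, hy, hqy⟩ := hq t ⟨by linarith, le_rfl⟩
      refine ⟨y, hy, p * g, Subgroup.mul_mem _ hpS hgS, k, hk, ?_⟩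
      have h1 := hβ.dist_right (t := t) ⟨by linarith, ht⟩
      have h2 := dist_triangle (γ y) (p • β t) ((p * g) • x)
      rw [mul_smul, dist_smul, h1, dist_comm (γ y) (p • β t)] at h2
      rw [mul_smul]
      linarith
  · obtain ⟨β, hβ⟩ := hX.1 x (wordProd M (B i) • x)
    obtain ⟨s, t, hs, ht, hst, hq⟩ := hN β hβ
    obtain ⟨r, hr, v, hv, j, hj, hrv⟩ := hm _ (wordProd_mem (hB i)) β hβ s t hs ht (by linarith)
    obtain ⟨y, hy, hqy⟩ := hq r hr
    refine ⟨y, hy, _, Subgroup.mul_mem _ (hpre i) (spanOf_mono M (Finset.erase_subset k S) hv), j,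
      Finset.mem_of_mem_erase hj, ?_⟩
    have h2 := dist_triangle (γ y)
      (altPrefix (M k) (fun i => wordProd M (B i)) (fun i => signUnit (e i)) i • β r)
      ((altPrefix (M k) (fun i => wordProd M (B i)) (fun i => signUnit (e i)) i * v) • x)
    rw [mul_smul, dist_smul, dist_comm (γ y)] at h2
    rw [mul_smul, dist_comm]
    rw [dist_comm (γ y)] at h2
    linarith

end Step

/-! ### The induction and the passage to the full tuple -/

section Main

/-- The geometry of the subgroups generated by at most `s` entries of a minimal tuple that is not
Nielsen-equivalent to a tuple with a first entry of small translation length. -/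
def SubtupleTheorem (s : ℕ) : Prop :=
  ∃ d₂ d₃ : ℝ, 0 < d₂ ∧ 0 < d₃ ∧ ∀ c : ℝ, 0 < c → ∃ d₁ d₄ : ℝ, 0 < d₁ ∧ 0 < d₄ ∧
    ∀ (n : ℕ) (G : Type u) (X : Type v) [Group G] [MetricSpace X] [MulAction G X]
      [IsIsometricSMul G X], IsHyperbolicSpace 1 X →
      ∀ (x : X) (M : Fin n → G), IsMinimalTuple x M → ¬ HasShortFirst X M d₁ →
        ∀ S : Finset (Fin n), S.card ≤ s →
          SubtupleGeometry x M S d₂ d₃ ∧ SubtupleMeets x M S c d₄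

lemma subtupleTheorem_zero : SubtupleTheorem.{u, v} 0 := by
  refine ⟨1, 1, one_pos, one_pos, fun c hc => ⟨1, 1, one_pos, one_pos, ?_⟩⟩
  intro n G X _ _ _ _ _ x M _ _ S hS
  obtain rfl : S = ∅ := Finset.card_eq_zero.1 (Nat.le_zero.1 hS)
  have hnil : ∀ w : List (Fin n × Bool), LettersIn ∅ w → w = [] := by
    intro w hw
    cases w with
    | nil => rfl
    | cons a w => exact absurd (hw a (by simp)) (by simp)
  refine ⟨⟨fun w _ hw hne => absurd (hnil w hw) hne, ⟨0, 0, le_rfl, le_rfl, fun w _ hw => ?_⟩,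
    fun w _ hw hne => absurd (hnil w hw) hne, fun w _ hw a ha => ?_⟩, ?_⟩
  · simp [hnil w hw]
  · rw [hnil w hw] at ha
    simp at ha
  · intro u hu γ _ a b ha hb hab
    have hu1 : u = 1 := by simpa [spanOf] using hu
    rw [hu1, one_smul, dist_self] at hb
    linarith

/-- The step of the induction on the size of the subtuple. -/
lemma SubtupleTheorem.step {s : ℕ} (h : SubtupleTheorem.{u, v} s) :
    ∃ d₂ d₃ : ℝ, 0 < d₂ ∧ 0 < d₃ ∧ ∀ T : ℝ, 1000 ≤ T → ∃ c₁ : ℝ, 0 < c₁ ∧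
      ∀ (n : ℕ) (G : Type u) (X : Type v) [Group G] [MetricSpace X] [MulAction G X]
        [IsIsometricSMul G X], IsHyperbolicSpace 1 X →
        ∀ (x : X) (M : Fin n → G), IsMinimalTuple x M → ¬ HasShortFirst X M c₁ →
          ∀ S : Finset (Fin n), S.card = s + 1 → ∀ k ∈ S,
            (∀ i ∈ S, disp x (M i) ≤ disp x (M k)) →
            SubtupleGeometry x M S d₂ d₃ ∧ ∀ r : ℝ, 16 ≤ r →
              AlternatingProductsTrack x (spanOf M (S.erase k)) (M k) r T := by
  obtain ⟨d₂, d₃, hd₂, hd₃, h⟩ := h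
  obtain ⟨e, d, he, hd, h1⟩ := h (1 + 68) (by norm_num)
  obtain ⟨e', d', he', hd', h2⟩ := h (d + 53 + 68) (by linarith)
  set ω := 3 * d + d' + 300 with hω
  have hω0 : 0 ≤ ω := by rw [hω]; linarith
  refine ⟨d₂ + 80, max d₃ (2 * ω + 6), by linarith, lt_max_of_lt_left hd₃, fun T hT => ?_⟩
  -- `R` depends on `T`, but `ω` does not; hence only the threshold for short entries depends on
  -- `T`. The next constant `c` can exceed `R` because `d₃` was fixed first.
  set R := 10 * T + 8 * ω + 200 with hR
  obtain ⟨e'', d'', he'', hd'', h3⟩ := h (R + 16 + d₃) (by linarith)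
  refine ⟨e + e' + e'' + (2 * R + 2), by linarith, ?_⟩
  intro n G X _ _ _ _ hX x M hM hshort S hS k hk hmax
  have hcard : (S.erase k).card ≤ s := by rw [Finset.card_erase_of_mem hk]; omega
  have g1 := h1 n G X hX x M hM (fun hs => hshort (hs.mono (by linarith)))
  have g2 := h2 n G X hX x M hM (fun hs => hshort (hs.mono (by linarith)))
  have g3 := h3 n G X hX x M hM (fun hs => hshort (hs.mono (by linarith)))
  have hmoves := lt_dist_of_mem_spanOf (R := R) hX (fun S hS => (g3 S hS).1)
    (fun S hS => (g3 S hS).2) (by linarith) (S.erase k) hcard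
  obtain ⟨m, E⟩ := exists_isEdge hX hM (Finset.notMem_erase k S)
    (fun i hi => hmax i (Finset.mem_of_mem_erase hi)) hd.le hd'.le (g1 _ hcard).2 (g2 _ hcard).2
    hmoves hshort (by linarith) (by linarith)
  exact ⟨E.subtupleGeometry hX (g1 _ hcard).1 hd₂.le hmax hω0 (by linarith),
    fun r hr => E.alternatingProductsTrack hX.fourPoint hω0 hT hr (by linarith)⟩

/-- The tracking scale may be chosen after `c`, so that a tracked piece is long enough to come `c`
closer to the orbit than half of an entry. -/
lemma SubtupleTheorem.succ {s : ℕ} (h : SubtupleTheorem.{u, v} s) :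
    SubtupleTheorem.{u, v} (s + 1) := by
  obtain ⟨d₂, d₃, hd₂, hd₃, hstep⟩ := h.step
  obtain ⟨d₂', d₃', hd₂', hd₃', h⟩ := h
  refine ⟨d₂ + d₂', d₃ + d₃', by linarith, by linarith, fun c hc => ?_⟩
  obtain ⟨e, d, he, hd, h1⟩ := h c hc
  obtain ⟨e', d', he', hd', h2⟩ := h (c + 16) (by linarith)
  obtain ⟨c₁, hc₁, hT⟩ := hstep (d' + 2 * c + 1000) (by linarith)
  refine ⟨e + e' + c₁, 10 * (d' + 2 * c + 1000) + d, by linarith, by linarith, ?_⟩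
  intro n G X _ _ _ _ hX x M hM hshort S hS
  rcases hS.lt_or_eq with hS | hS
  · obtain ⟨k1, k2⟩ := h1 n G X hX x M hM (fun hs => hshort (hs.mono (by linarith))) S
      (Nat.lt_succ_iff.1 hS)
    exact ⟨k1.mono (by linarith) (by linarith), k2.mono le_rfl (by linarith)⟩
  · have hne : S.Nonempty := Finset.card_pos.1 (by omega)
    obtain ⟨k, hk, hmax⟩ := S.exists_max_image (fun i => disp x (M i)) hne
    obtain ⟨k1, k2⟩ := hT n G X hX x M hM (fun hs => hshort (hs.mono (by linarith))) S hS k hk hmax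
    obtain ⟨k3, k4⟩ := h2 n G X hX x M hM (fun hs => hshort (hs.mono (by linarith))) (S.erase k)
      (by rw [Finset.card_erase_of_mem hk]; omega)
    exact ⟨k1.mono (by linarith) (by linarith),
      (subtupleMeets_of_track hX hk k3 k4 hd'.le (by linarith) (by linarith)
        (k2 16 le_rfl)).mono le_rfl (by linarith)⟩

lemma subtupleTheorem (s : ℕ) : SubtupleTheorem.{u, v} s := by
  induction s with
  | zero => exact subtupleTheorem_zero
  | succ s ih => exact ih.succ

variable {G : Type u} {X : Type v} [Group G] [MetricSpace X] [MulAction G X] {n : ℕ} {x : X}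
  {M : Fin n → G} {d₂ d₃ : ℝ}

lemma lettersIn_univ (w : List (Fin n × Bool)) : LettersIn Finset.univ w :=
  fun _ _ => Finset.mem_univ _

lemma SubtupleGeometry.isFreelyGenerating (h : SubtupleGeometry x M Finset.univ d₂ d₃) :
    IsFreelyGenerating M := by
  refine (injective_iff_map_eq_one _).2 fun a ha => ?_
  by_contra h1
  rw [lift_eq_wordProd] at ha
  exact h.ne_one _ FreeGroup.isReduced_toWord (lettersIn_univ _)
    (fun h0 => h1 (FreeGroup.toWord_eq_nil_iff.1 h0)) ha

variable [IsIsometricSMul G X]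

lemma disp_wordProd_le {C : ℝ} (hC : ∀ i, disp x (M i) ≤ C) (w : List (Fin n × Bool)) :
    disp x (wordProd M w) ≤ C * w.length := by
  induction w with
  | nil => simp [disp]
  | cons a w ih =>
    have h1 : disp x (letter M a) ≤ C := by
      rcases a with ⟨i, b⟩
      cases b <;> simp [letter, disp_inv, hC]
    have h2 := dist_triangle x (letter M a • x) ((letter M a * wordProd M w) • x)
    have h3 := dist_smul_smul_mul x (letter M a) (wordProd M w)
    rw [wordProd_cons, List.length_cons]
    push_cast
    unfold disp at *
    linarith

lemma SubtupleGeometry.orbitMapIsQIEmbedding (h : SubtupleGeometry x M Finset.univ d₂ d₃) :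
    OrbitMapIsQIEmbedding x M := by
  obtain ⟨lam, ε, hlam, hε, hqi⟩ := h.qi
  have hsum : ∀ i, disp x (M i) ≤ ∑ j, disp x (M j) := fun i =>
    Finset.single_le_sum (f := fun j => disp x (M j)) (fun j _ => dist_nonneg)
      (Finset.mem_univ i)
  have hC0 : 0 ≤ ∑ j, disp x (M j) := Finset.sum_nonneg fun j _ => dist_nonneg
  set C := ∑ j, disp x (M j) with hC
  refine ⟨lam + C + 1, ε, by linarith, hε, fun a b => ?_⟩
  have hd : dist (FreeGroup.lift M a • x) (FreeGroup.lift M b • x) =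
      disp x (wordProd M (a⁻¹ * b).toWord) := by
    rw [← lift_eq_wordProd, map_mul, map_inv, ← dist_smul (FreeGroup.lift M a)⁻¹, inv_smul_smul,
      smul_smul, disp]
  rw [hd, FreeGroup.norm]
  have h1 := hqi _ FreeGroup.isReduced_toWord (lettersIn_univ (a⁻¹ * b).toWord)
  have h2 := disp_wordProd_le hsum (a⁻¹ * b).toWord
  have h3 : (0 : ℝ) ≤ ((a⁻¹ * b).toWord.length : ℝ) := Nat.cast_nonneg _
  have h4 : 0 ≤ disp x (wordProd M (a⁻¹ * b).toWord) := dist_nonneg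
  constructor
  · rw [sub_le_iff_le_add, div_le_iff₀ (by linarith)]
    nlinarith [mul_nonneg hC0 h4, mul_nonneg hlam hε, mul_nonneg hC0 hε]
  · nlinarith [mul_nonneg hlam h3]

lemma SubtupleGeometry.fellowTravels (hF : FourPoint X) (hd₂ : 0 ≤ d₂)
    (h : SubtupleGeometry x M Finset.univ d₂ d₃) : FellowTravels x M (d₂ + 4) := by
  intro w hw γ hγ t ht
  -- The word need not be reduced. If it cancels completely, the geodesic is the base-point;
  -- otherwise the letters of the reduction occur in `w` with the same prefix products.
  by_cases hnil : FreeGroup.reduce w = []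
  · have h1 : wordProd M w = 1 := by rw [← wordProd_reduce, hnil, wordProd_nil]
    have hpos : 0 < w.length := List.length_pos_iff.2 hw
    refine ⟨⟨0, hpos⟩, fun β hβ => ⟨0, ⟨le_rfl, dist_nonneg⟩, ?_⟩⟩
    have h2 := hγ.dist_left ht
    rw [h1, one_smul, dist_self] at ht
    rw [hβ.1, List.take_zero, wordProd_nil, one_smul, dist_comm, h2]
    linarith [ht.2]
  · have hon : AlmostOn x 1 (wordProd M (FreeGroup.reduce w)) 24 (γ t) := by
      have h1 := hγ.dist_left ht
      have h2 := hγ.dist_right ht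
      rw [wordProd_reduce]
      simp only [AlmostOn, one_smul, one_mul, disp]
      linarith
    obtain ⟨p, a, q, hsplit, hp⟩ := h.fellow _ (isReduced_reduce w) (lettersIn_univ _) hnil _ hon
    obtain ⟨p', q', rfl, hpp⟩ := exists_split_of_red (M := M) FreeGroup.reduce.red p a q hsplit
    refine ⟨⟨p'.length, by simp⟩, fun β hβ => ?_⟩
    have hget : (p' ++ a :: q').get ⟨p'.length, by simp⟩ = a := by simp
    rw [hget] at hβ ⊢
    have hβ' := hβ.smul (wordProd M p')
    rw [← hpp] at hp
    rw [smul_smul] at hβ'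
    have hlen := dist_smul_smul_mul x (wordProd M p') (letter M a)
    obtain ⟨s, hs, hnear⟩ := hF.exists_near hβ' (z := γ t) (ε := d₂) (by rw [hlen]; exact hp)
    rw [hlen] at hs
    refine ⟨s, hs, ?_⟩
    simpa using hnear

end Main

end NielsenHyp

theorem proposition13 (K L N₀ : ℕ) (hconst : AdmissibleConstants.{v} K L N₀)
    (n : ℕ) (hn : 2 ≤ n) (h11 : TechnicalTheorem.{u, v} (n - 1)) :
    ∃ c₂ c₃ : ℝ, 0 < c₂ ∧ 0 < c₃ ∧
      ∀ T : ℝ, (N1 K L N₀ : ℝ) ≤ T → ∃ c₁ : ℝ, 0 < c₁ ∧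
        ∀ (G : Type u) (X : Type v) [Group G] [MetricSpace X] [MulAction G X]
          [IsIsometricSMul G X], IsHyperbolicSpace 1 X →
          ∀ (x : X) (M : Fin n → G) (last : Fin n), (last : ℕ) = n - 1 →
            IsMinimalTuple x M →
            (∀ i, disp x (M i) ≤ disp x (M last)) →
            HasShortFirst X M c₁ ∨
            (IsFreelyGenerating M ∧
              OrbitMapIsQIEmbedding x M ∧
              FellowTravels x M c₂ ∧
              LengthBound x M c₃ ∧
              AlternatingProductsTrack x (Subgroup.closure (M '' {i | i ≠ last})) (M last)
                (2 * (L : ℝ) + 100) T) := by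
  obtain ⟨d₂, d₃, hd₂, hd₃, h⟩ := (subtupleTheorem.{u, v} (n - 1)).step
  refine ⟨d₂ + 4, d₃, by linarith, hd₃, fun T hT => ?_⟩
  have hN : 1000 ≤ N1 K L N₀ := by
    obtain ⟨hK, hL, hN₀, -⟩ := hconst
    have : 0 < L * K ^ 2 * N₀ := by positivity
    rw [N1, mul_assoc, mul_assoc, ← mul_assoc L]
    omega
  have hT' : 1000 ≤ T := le_trans (by exact_mod_cast hN) hT
  obtain ⟨c₁, hc₁, h⟩ := h T hT'
  refine ⟨c₁, hc₁, fun G X _ _ _ _ hX x M last _ hM hmax => ?_⟩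
  by_cases hshort : HasShortFirst X M c₁
  · exact Or.inl hshort
  · right
    obtain ⟨hg, htrack⟩ := h n G X hX x M hM hshort Finset.univ (by simp; omega) last
      (Finset.mem_univ _) (fun i _ => hmax i)
    have hset : ((Finset.univ.erase last : Finset (Fin n)) : Set (Fin n)) = {i | i ≠ last} := by
      ext i
      simp
    have ht := htrack (2 * (L : ℝ) + 100) (by linarith [Nat.cast_nonneg (α := ℝ) L])
    rw [spanOf, hset] at ht
    exact ⟨hg.isFreelyGenerating, hg.orbitMapIsQIEmbedding,
      hg.fellowTravels hX.fourPoint hd₂.le,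
      fun w hw a ha => hg.length w hw (lettersIn_univ w) a ha, ht⟩
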